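/- Let $\mathbb F$ be a field of characteristic $0$ and let $\mathcal V$ be a differential algebra: a unital commutative associative $\mathbb F$-algebra with an $\mathbb F$-linear derivation $\partial$. Let $\mathcal V((\partial^{-1}))$ be the algebra of pseudodifferential operators $A(\partial)=\sum_{n\le K}a_n\partial^n$ over $\mathcal V$; the symbol of $A(\partial)$ is $A(z)=\sum_{n\le K} a_nz^n$, the product is $(A\circ B)(z)=A(z+\partial)B(z)$, with powers of $z+\partial$ expanded in nonnegative powers of $\partial$, and the formal adjoint is $A^*(\partial)=\sum_n(-\partial)^n\circ a_n$. Let $\{\cdot\,_\lambda\,\cdot\}$ be a $\lambda$-bracket on $\mathcal V$, i.e. an $\mathbb F$-bilinear map $\mathcal V\times\mathcal V\to\mathcal V[\lambda]$ such that, for all $a,b,c\in\mathcal V$, $$\{\partial a_\lambda b\}=-\lambda\{a_\lambda b\},\qquad \{a_\lambda\partial b\}=(\lambda+\partial)\{a_\lambda b\},\qquad \{a_\lambda bc\}=\{a_\lambda b\}c+\{a_\lambda c\}b,$$ $$\{ab_\lambda c\}=\{a_{\lambda+x}c\}\big(\big|_{x=\partial}b\big)+\{b_{\lambda+x}c\}\big(\big|_{x=\partial}a\big),$$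 where $P(\lambda+x)\big(\big|_{x=\partial}b\big)=\sum_n p_n(\lambda+\partial)^nb$ for $P(\lambda)=\sum_n p_n\lambda^n\in\mathcal V[\lambda]$. (Skewsymmetry and the Jacobi identity are not assumed.) A matrix pseudodifferential operator $A(\partial)\in\mathrm{Mat}_{P\times R}\,\mathcal V((\partial^{-1}))$ is of Adler type with respect to $\{\cdot\,_\lambda\,\cdot\}$ if, for all $i,h\in\{1,\dots,P\}$ and $j,k\in\{1,\dots,R\}$, $$\{A_{ij}(z)_\lambda A_{hk}(w)\}=A_{hj}(w+\lambda+\partial)\,\iota_z(z-w-\lambda-\partial)^{-1}(A_{ik})^*(\lambda-z)-A_{hj}(z)\,\iota_z(z-w-\lambda-\partial)^{-1}A_{ik}(w),$$ as an identity of formal series in $z,w$ with coefficients in $\mathcal V[\lambda]$. Here $\iota_z(z-w-\lambda-\partial)^{-1}=\sum_{p\ge0}z^{-p-1}(w+\lambda+\partial)^p$, powers of $w+\lambda+\partial$ and of $\lambda-z$ are expanded in nonnegative powers of $\lambda+\partial$ and of $\lambda$ respectively, and $\partial$ acts on the coefficients of the series to its right. **Proposition.** Let $M\le N$, let $A(\partial)\in\mathrm{Mat}_{N\times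 N}\,\mathcal V((\partial^{-1}))$ be of Adler type with respect to $\{\cdot\,_\lambda\,\cdot\}$, and let $I\in\mathrm{Mat}_{N\times M}\,\mathbb F$ and $J\in\mathrm{Mat}_{M\times N}\,\mathbb F$ be constant matrices. Suppose that the generalized quasideterminant $$|A(\partial)|_{IJ}=(J\,A(\partial)^{-1}I)^{-1}$$ exists, i.e. that $A(\partial)$ is invertible in $\mathrm{Mat}_{N\times N}\,\mathcal V((\partial^{-1}))$ and $J A(\partial)^{-1}I$ is invertible in $\mathrm{Mat}_{M\times M}\,\mathcal V((\partial^{-1}))$. Then $|A(\partial)|_{IJ}$ is a matrix pseudodifferential operator of Adler type with respect to the same $\lambda$-bracket $\{\cdot\,_\lambda\,\cdot\}$. -/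

import Mathlib

open Polynomial

noncomputable section

namespace AdlerType

variable {F V : Type*} [Field F] [CommRing V] [Algebra F V]

/-! ### Pseudodifferential operators over the differential algebra `(V, d)` -/

/-- The two-sided sequences of elements of `V` that vanish in all large enough degrees, i.e. the
formal Laurent series `∑_{n ≤ N} a_n z^n` in `z⁻¹`. -/
def boundedAbove (V : Type*) [CommRing V] : AddSubgroup (ℤ → V) where
  carrier := {a | ∃ N : ℤ, ∀ n, N < n → a n = 0}
  zero_mem' := ⟨0, fun _ _ => rfl⟩
  add_mem' := by
    rintro a b ⟨N, hN⟩ ⟨K, hK⟩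
    refine ⟨max N K, fun n hn => ?_⟩
    simp [hN n (lt_of_le_of_lt (le_max_left _ _) hn), hK n (lt_of_le_of_lt (le_max_right _ _) hn)]
  neg_mem' := by
    rintro a ⟨N, hN⟩
    exact ⟨N, fun n hn => by simp [hN n hn]⟩

/-- Scalar pseudodifferential operators `∑_{n ≤ N} a_n ∂^n` over the differential algebra `V`
with derivation `d`, recorded by their coefficients.  The derivation is a parameter of the type
because the product depends on it. -/
def PseudoDiffOp (_d : Derivation F V V) : Type _ := boundedAbove V

namespace PseudoDiffOp

variable {d : Derivation F V V}

instance : AddCommGroup (PseudoDiffOp d) := inferInstanceAs (AddCommGroup (boundedAbove V))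

/-- The coefficient `a_n` of `∂^n` in `A(∂) = ∑ a_n ∂^n` (equally, of `z^n` in the symbol). -/
def coeff (A : PseudoDiffOp d) (n : ℤ) : V := A.1 n

theorem coeff_bounded (A : PseudoDiffOp d) : ∃ N : ℤ, ∀ n, N < n → A.coeff n = 0 := A.2

/-- The operator of multiplication by a constant of the base field. -/
def const (d : Derivation F V V) (c : F) : PseudoDiffOp d :=
  ⟨fun n => if n = 0 then algebraMap F V c else 0, 0, fun _ hn => if_neg hn.ne'⟩

instance : One (PseudoDiffOp d) := ⟨const d 1⟩

/-- The product `(A ∘ B)(z) = A(z + ∂) B(z)`, with `(z + ∂)^m` expanded in nonnegative powers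
of `∂`:  `(A ∘ B)_n = ∑_{m ∈ ℤ, k ≥ 0} binom(m, k) a_m ∂^k(b_{n - m + k})`, a finite sum. -/
instance : Mul (PseudoDiffOp d) where
  mul A B :=
    ⟨fun n => ∑ᶠ x : ℤ × ℕ, Ring.choose x.1 x.2 •
        (A.coeff x.1 * ((d : V →ₗ[F] V) ^ x.2) (B.coeff (n - x.1 + x.2))), by
      obtain ⟨N, hN⟩ := A.coeff_bounded
      obtain ⟨K, hK⟩ := B.coeff_bounded
      refine ⟨N + K, fun n hn => finsum_eq_zero_of_forall_eq_zero fun x => ?_⟩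
      by_cases h : N < x.1
      · simp [hN _ h]
      · rw [hK (n - x.1 + x.2) (by omega)]
        simp⟩

/-- The formal adjoint `A^*(∂) = ∑_n (-∂)^n ∘ a_n`; since
`(-∂)^m ∘ a = (-1)^m ∑_{k ≥ 0} binom(m, k) ∂^k(a) ∂^{m - k}`, its coefficient of `∂^n` is the
finite sum `∑_{k ≥ 0} (-1)^{n + k} binom(n + k, k) ∂^k(a_{n + k})`. -/
def adjoint (A : PseudoDiffOp d) : PseudoDiffOp d :=
  ⟨fun n => ∑ᶠ k : ℕ, (((n + k).negOnePow : ℤ) * Ring.choose (n + k) k) •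
      ((d : V →ₗ[F] V) ^ k) (A.coeff (n + k)), by
    obtain ⟨N, hN⟩ := A.coeff_bounded
    refine ⟨N, fun n hn => finsum_eq_zero_of_forall_eq_zero fun k => ?_⟩
    rw [hN (n + k) (by omega)]
    simp⟩

end PseudoDiffOp

/-! ### `λ`-brackets.  The variable `λ` is `X` in `V[X]`. -/

/-- The operator `λ + ∂` on `V[λ]`, where `∂` acts on coefficients. -/
def lamAdd (d : Derivation F V V) : V[X] →ₗ[F] V[X] :=
  LinearMap.mulLeft F X +
    lsum fun n => (monomial n : V →ₗ[V] V[X]).restrictScalars F ∘ₗ (d : V →ₗ[F] V)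

/-- `P(λ + x) (|_{x = ∂} b) = ∑_n p_n (λ + ∂)^n b` for `P(λ) = ∑_n p_n λ^n`. -/
def substApply (d : Derivation F V V) (P : V[X]) (b : V) : V[X] :=
  P.sum fun n p => C p * (lamAdd d ^ n) (C b)

/-- A `λ`-bracket on the differential algebra `(V, d)`: a bilinear map `V × V → V[λ]` with
sesquilinearity and the two Leibniz rules (neither skewsymmetry nor the Jacobi identity). -/
structure LambdaBracket (d : Derivation F V V) where
  /-- `br a b = {a_λ b}` -/
  br : V →ₗ[F] V →ₗ[F] V[X]
  deriv_left : ∀ a b, br (d a) b = -(X * br a b)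
  deriv_right : ∀ a b, br a (d b) = lamAdd d (br a b)
  leibniz_right : ∀ a b c, br a (b * c) = br a b * C c + br a c * C b
  leibniz_left : ∀ a b c, br (a * b) c = substApply d (br a c) b + substApply d (br b c) a

/-! ### The Adler identity

Both sides are formal series in `z, w` (of both signs of degree) with coefficients in `V[λ]`, and
are given by their coefficients of `z^r w^s`. -/

namespace PseudoDiffOp

variable {d : Derivation F V V}

/-- The coefficient of `z^r` in `A(λ - z)`, expanded in nonnegative powers of `λ`:
`a_m (λ - z)^m = a_m ∑_{l ≥ 0} (-1)^{m - l} binom(m, l) λ^l z^{m - l}`. -/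
def evalLamSub (A : PseudoDiffOp d) (r : ℤ) : V[X] :=
  ∑ᶠ l : ℕ, ((r.negOnePow : ℤ) * Ring.choose (r + l) l) • monomial l (A.coeff (r + l))

/-- The coefficient of `z^r w^s` in
`B(w + λ + ∂) ι_z(z - w - λ - ∂)⁻¹ A^*(λ - z)`, where
`ι_z(z - w - λ - ∂)⁻¹ = ∑_{p ≥ 0} z^{-p-1} (w + λ + ∂)^p` and the powers
`(w + λ + ∂)^{m + p} = ∑_{q ≥ 0} binom(m + p, q) w^{m + p - q} (λ + ∂)^q`, `m ∈ ℤ`, which arise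
from `B(w + λ + ∂) = ∑_m b_m (w + λ + ∂)^m`, act on the coefficients of `A^*(λ - z)`.
(Here `m = s + q - p`.) -/
def adlerFst (B A : PseudoDiffOp d) (r s : ℤ) : V[X] :=
  ∑ᶠ x : ℕ × ℕ, Ring.choose (s + x.2) x.2 •
    (C (B.coeff (s + x.2 - x.1)) * (lamAdd d ^ x.2) (A.adjoint.evalLamSub (r + x.1 + 1)))

/-- The coefficient of `z^r w^s` in `B(z) ι_z(z - w - λ - ∂)⁻¹ A(w)`, where
`ι_z(z - w - λ - ∂)⁻¹ = ∑_{p ≥ 0} z^{-p-1} ∑_q binom(p, q) w^{p - q} (λ + ∂)^q` acts on the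
coefficients of `A(w)`. -/
def adlerSnd (B A : PseudoDiffOp d) (r s : ℤ) : V[X] :=
  ∑ᶠ x : ℕ × ℕ, x.1.choose x.2 •
    (C (B.coeff (r + x.1 + 1)) * (lamAdd d ^ x.2) (C (A.coeff (s + x.2 - x.1))))

/-! All the sums above are finite. -/

theorem finite_support_mul (A B : PseudoDiffOp d) (n : ℤ) :
    (Function.support fun x : ℤ × ℕ => Ring.choose x.1 x.2 •
      (A.coeff x.1 * ((d : V →ₗ[F] V) ^ x.2) (B.coeff (n - x.1 + x.2)))).Finite := by
  obtain ⟨N, hN⟩ := A.coeff_bounded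
  obtain ⟨K, hK⟩ := B.coeff_bounded
  refine ((Set.finite_Icc (n - K) N).prod (Set.finite_Iic (K - n + N).toNat)).subset ?_
  rintro ⟨m, k⟩ hx
  have h1 : m ≤ N := by
    by_contra h
    exact hx (by simp [hN m (by omega)])
  have h2 : n - m + k ≤ K := by
    by_contra h
    exact hx (by simp [hK (n - m + k) (by omega)])
  simp only [Set.mem_prod, Set.mem_Icc, Set.mem_Iic]
  omega

theorem finite_support_adjoint (A : PseudoDiffOp d) (n : ℤ) :
    (Function.support fun k : ℕ => (((n + k).negOnePow : ℤ) * Ring.choose (n + k) k) •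
      ((d : V →ₗ[F] V) ^ k) (A.coeff (n + k))).Finite := by
  obtain ⟨N, hN⟩ := A.coeff_bounded
  refine (Set.finite_Iic (N - n).toNat).subset fun k hx => ?_
  have h1 : n + k ≤ N := by
    by_contra h
    exact hx (by simp [hN (n + k) (by omega)])
  simp only [Set.mem_Iic]
  omega

theorem finite_support_evalLamSub (A : PseudoDiffOp d) (r : ℤ) :
    (Function.support fun l : ℕ => ((r.negOnePow : ℤ) * Ring.choose (r + l) l) •
      monomial l (A.coeff (r + l))).Finite := by
  obtain ⟨N, hN⟩ := A.coeff_bounded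
  refine (Set.finite_Iic (N - r).toNat).subset fun k hx => ?_
  have h1 : r + k ≤ N := by
    by_contra h
    exact hx (by simp [hN (r + k) (by omega)])
  simp only [Set.mem_Iic]
  omega

theorem evalLamSub_bounded (A : PseudoDiffOp d) : ∃ N : ℤ, ∀ r, N < r → A.evalLamSub r = 0 := by
  obtain ⟨N, hN⟩ := A.coeff_bounded
  refine ⟨N, fun r hr => finsum_eq_zero_of_forall_eq_zero fun l => ?_⟩
  rw [hN (r + l) (by omega)]
  simp

theorem finite_support_adlerFst (B A : PseudoDiffOp d) (r s : ℤ) :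
    (Function.support fun x : ℕ × ℕ => Ring.choose (s + x.2) x.2 •
      (C (B.coeff (s + x.2 - x.1)) *
        (lamAdd d ^ x.2) (A.adjoint.evalLamSub (r + x.1 + 1)))).Finite := by
  obtain ⟨N, hN⟩ := A.adjoint.evalLamSub_bounded
  obtain ⟨K, hK⟩ := B.coeff_bounded
  refine ((Set.finite_Iic (N - r - 1).toNat).prod
    (Set.finite_Iic (K - s + (N - r - 1).toNat).toNat)).subset ?_
  rintro ⟨p, q⟩ hx
  have h1 : r + p + 1 ≤ N := by
    by_contra h
    exact hx (by simp [hN (r + p + 1) (by omega)])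
  have h2 : s + q - p ≤ K := by
    by_contra h
    exact hx (by simp [hK (s + q - p) (by omega)])
  simp only [Set.mem_prod, Set.mem_Iic]
  omega

theorem finite_support_adlerSnd (B A : PseudoDiffOp d) (r s : ℤ) :
    (Function.support fun x : ℕ × ℕ => x.1.choose x.2 •
      (C (B.coeff (r + x.1 + 1)) *
        (lamAdd d ^ x.2) (C (A.coeff (s + x.2 - x.1))))).Finite := by
  obtain ⟨K, hK⟩ := B.coeff_bounded
  refine ((Set.finite_Iic (K - r - 1).toNat).prod
    (Set.finite_Iic (K - r - 1).toNat)).subset ?_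
  rintro ⟨p, q⟩ hx
  have h1 : r + p + 1 ≤ K := by
    by_contra h
    exact hx (by simp [hK (r + p + 1) (by omega)])
  have h2 : q ≤ p := by
    by_contra h
    exact hx (by simp [Nat.choose_eq_zero_of_lt (by omega : p < q)])
  simp only [Set.mem_prod, Set.mem_Iic]
  omega

end PseudoDiffOp

/-- The matrix pseudodifferential operator `A(∂)` is of Adler type with respect to the
`λ`-bracket `L`: for all `i, j, h, k`,
`{A_ij(z)_λ A_hk(w)} = A_hj(w+λ+∂) ι_z(z-w-λ-∂)⁻¹ (A_ik)^*(λ-z) - A_hj(z) ι_z(z-w-λ-∂)⁻¹ A_ik(w)`,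
as an equality of the coefficients of all monomials `z^r w^s`. -/
def IsAdlerType {d : Derivation F V V} (L : LambdaBracket d) {m n : Type*}
    (A : Matrix m n (PseudoDiffOp d)) : Prop :=
  ∀ (i : m) (j : n) (h : m) (k : n) (r s : ℤ),
    L.br ((A i j).coeff r) ((A h k).coeff s) =
      PseudoDiffOp.adlerFst (A h j) (A i k) r s - PseudoDiffOp.adlerSnd (A h j) (A i k) r s

/-- `B` is the two-sided inverse of the square matrix pseudodifferential operator `A`. -/
def IsInverse {d : Derivation F V V} {n : Type*} [Fintype n] [DecidableEq n]
    (A B : Matrix n n (PseudoDiffOp d)) : Prop :=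
  A * B = 1 ∧ B * A = 1

/-- The generalized quasideterminant `|A|_{IJ} = (J A⁻¹ I)⁻¹` exists and is equal to `Q`:
`A` has an inverse `B`, and `J B I` has the inverse `Q`. -/
def IsQuasideterminant {d : Derivation F V V} {m n : Type*} [Fintype m] [DecidableEq m]
    [Fintype n] [DecidableEq n] (A : Matrix n n (PseudoDiffOp d))
    (I : Matrix n m (PseudoDiffOp d)) (J : Matrix m n (PseudoDiffOp d))
    (Q : Matrix m m (PseudoDiffOp d)) : Prop :=
  ∃ B : Matrix n n (PseudoDiffOp d), IsInverse A B ∧ IsInverse (J * B * I) Q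

end AdlerType

end

noncomputable section

namespace AdlerType

/-! ### Finitely supported sums over ℤ and ℕ -/

section

variable {F V : Type*} [Field F] [CommRing V] [Algebra F V]

/-! The Adler identity is linearized by testing against operators. Let `W` be a differential algebra
over `V`, and for a matrix `P` over `W((∂⁻¹))` let δ be the derivation `V → W` obtained from `∫ tr
Res (P ∘ dA)` by replacing `∫ f da` with the derivation `c ↦ {a_∂ c} f`. Taking `P = ∂^{-r-1} ∘ f`
in one matrix entry isolates the coefficient of `z^r`, with `λ` replaced by `∂` acting on `f`, and
the Adler identity becomes `δ(A) = A (PA)_+ - (AP)_+ A`, the Adler–Gelfand–Dickey (AGD) identity.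

The AGD identity is stable under the operations that build a quasideterminant. By the Leibniz rule
and cyclicity of the pairing (`pairing_mul`), the derivation attached to `A⁻¹` and `P` is minus the
one attached to `A` and `A⁻¹ P A⁻¹`. Substituting this in `δ(A⁻¹) = -A⁻¹ δ(A) A⁻¹` gives the
identity for `A⁻¹` with the opposite sign (`IsAGD.inverse`). For `J A I` with constant `I`, `J`,
test `A` against `I P J`: constants are killed by every bracket and commute with taking differential
parts, so the sign is kept (`IsAGD.const_mul_mul_const`). Two inversions restore the sign.

To return to the Adler identity, which lives in `V[λ]`, some `f` must be such that `P(∂) f`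
determines `P`. `V` need not contain one (its derivation may be zero), so the argument runs over `W
= V[X]` with `X' = X²`: there `∂^n X = n! X^{n+1}`, and characteristic 0 makes `X` such an element.
-/

theorem finite_support_of_bounded {M : Type*} [Zero M] {g : ℤ → M} (a b : ℤ)
    (ha : ∀ n, n < a → g n = 0) (hb : ∀ n, b < n → g n = 0) : (Function.support g).Finite := by
  refine (Set.finite_Icc a b).subset fun n hn => ⟨?_, ?_⟩ <;> by_contra h
  · exact hn (ha n (by omega))
  · exact hn (hb n (by omega))

theorem finite_support_of_bounded_nat {M : Type*} [Zero M] {g : ℕ → M} (b : ℤ)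
    (hb : ∀ n : ℕ, b < n → g n = 0) : (Function.support g).Finite := by
  refine (Set.finite_Iic b.toNat).subset fun n hn => ?_
  by_contra h
  exact hn (hb n (by simp only [Set.mem_Iic] at h; omega))

theorem finsum_nat_eq_add {M : Type*} [AddCommMonoid M] {f : ℕ → M}
    (hf : (Function.support f).Finite) : ∑ᶠ k, f k = f 0 + ∑ᶠ k, f (k + 1) := by
  obtain ⟨N, hN⟩ := hf.bddAbove
  rw [finsum_eq_sum_of_support_subset (s := Finset.range (N + 1)), Finset.sum_range_succ',
    add_comm, finsum_eq_sum_of_support_subset (s := Finset.range N)]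
  · intro k hk
    have := hN (show k + 1 ∈ Function.support f from hk)
    simpa using this
  · intro k hk
    simpa [Nat.lt_succ_iff] using hN hk

/-! ### Coefficients, monomials and induction on the order -/

namespace PseudoDiffOp

variable {d : Derivation F V V}

@[ext] theorem ext {A B : PseudoDiffOp d} (h : ∀ n, A.coeff n = B.coeff n) : A = B :=
  Subtype.ext (funext h)

@[simp] theorem coeff_add (A B : PseudoDiffOp d) (n : ℤ) :
    (A + B).coeff n = A.coeff n + B.coeff n := rfl

@[simp] theorem coeff_sub (A B : PseudoDiffOp d) (n : ℤ) :
    (A - B).coeff n = A.coeff n - B.coeff n := rfl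

@[simp] theorem coeff_zero (n : ℤ) : (0 : PseudoDiffOp d).coeff n = 0 := rfl

theorem coeff_const (c : F) (n : ℤ) :
    (const d c).coeff n = if n = 0 then algebraMap F V c else 0 := rfl

/-- The coefficient of `∂^n` as an additive map. -/
def coeffHom (d : Derivation F V V) (n : ℤ) : PseudoDiffOp d →+ V where
  toFun A := A.coeff n
  map_zero' := rfl
  map_add' _ _ := rfl

@[simp] theorem coeffHom_apply (A : PseudoDiffOp d) (n : ℤ) : coeffHom d n A = A.coeff n := rfl

/-- `A` has order at most `N`. -/
def OrderLE (A : PseudoDiffOp d) (N : ℤ) : Prop := ∀ n, N < n → A.coeff n = 0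

/-- The monomial `a ∂^m`. -/
def mono (d : Derivation F V V) (m : ℤ) (a : V) : PseudoDiffOp d :=
  ⟨fun n => if n = m then a else 0, m, fun _ hn => if_neg hn.ne'⟩

theorem coeff_mono (m : ℤ) (a : V) (n : ℤ) :
    (mono d m a).coeff n = if n = m then a else 0 := rfl

theorem mono_add (m : ℤ) (a b : V) : mono d m (a + b) = mono d m a + mono d m b := by
  ext n
  simp only [coeff_mono, coeff_add]
  split_ifs <;> simp

theorem const_eq_mono (c : F) : const d c = mono d 0 (algebraMap F V c) := rfl

theorem one_eq_mono : (1 : PseudoDiffOp d) = mono d 0 1 := by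
  ext n
  change (const d 1).coeff n = _
  rw [const_eq_mono, map_one]

theorem mono_orderLE (m : ℤ) (a : V) : (mono d m a).OrderLE m := fun _ hn => if_neg hn.ne'

/-- An additive property of operators which holds in low orders and for operators with arbitrary
leading terms holds for all operators. -/
theorem order_induction {P : PseudoDiffOp d → Prop} (hadd : ∀ A B, P A → P B → P (A + B))
    (N : ℤ) (hlow : ∀ A : PseudoDiffOp d, A.OrderLE N → P A) (E : ℤ → V → PseudoDiffOp d)
    (hE : ∀ m a, (E m a - mono d m a).OrderLE (m - 1)) (hP : ∀ m a, P (E m a))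
    (A : PseudoDiffOp d) : P A := by
  have key : ∀ k : ℕ, ∀ A : PseudoDiffOp d, A.OrderLE (N + k) → P A := by
    intro k
    induction k with
    | zero => exact fun A hA => hlow A (by simpa using hA)
    | succ k ih =>
      intro A hA
      -- Splitting off the top coefficient lowers the order by one. Finitely many splittings reach
      -- order `N`, so no infinite sum of operators is needed.
      have h : A = E (N + k + 1) (A.coeff (N + k + 1)) +
          (A - E (N + k + 1) (A.coeff (N + k + 1))) := by abel
      rw [h]
      refine hadd _ _ (hP _ _) (ih _ fun n hn => ?_)
      have h1 := hE (N + k + 1) (A.coeff (N + k + 1)) n (by omega)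
      rw [coeff_sub, coeff_mono, sub_eq_zero] at h1
      rw [coeff_sub, h1]
      split_ifs with h2
      · rw [h2, sub_self]
      · rw [hA n (by push_cast; omega), sub_zero]
  obtain ⟨K, hK⟩ := A.coeff_bounded
  exact key (K - N).toNat A fun n hn => hK n (by omega)

/-! ### The ring of pseudodifferential operators -/

theorem finite_support_lshift (m : ℤ) (B : PseudoDiffOp d) (n : ℤ) :
    (Function.support fun k : ℕ => Ring.choose m k •
      ((d : V →ₗ[F] V) ^ k) (B.coeff (n - m + k))).Finite := by
  obtain ⟨K, hK⟩ := B.coeff_bounded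
  refine finite_support_of_bounded_nat (K - n + m) fun k hk => ?_
  rw [hK _ (by omega), map_zero, smul_zero]

/-- Left multiplication by `∂^m`. -/
def lshift (m : ℤ) : PseudoDiffOp d →+ PseudoDiffOp d where
  toFun B := ⟨fun n => ∑ᶠ k : ℕ, Ring.choose m k • ((d : V →ₗ[F] V) ^ k) (B.coeff (n - m + k)), by
    obtain ⟨K, hK⟩ := B.coeff_bounded
    refine ⟨m + K, fun n hn => finsum_eq_zero_of_forall_eq_zero fun k => ?_⟩
    rw [hK _ (by omega), map_zero, smul_zero]⟩
  map_zero' := by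
    ext n
    exact finsum_eq_zero_of_forall_eq_zero fun k => by simp
  map_add' A B := by
    ext n
    refine Eq.trans ?_ (finsum_add_distrib (finite_support_lshift m A n)
      (finite_support_lshift m B n))
    exact finsum_congr fun k => by simp

theorem coeff_lshift (m : ℤ) (B : PseudoDiffOp d) (n : ℤ) : (lshift m B).coeff n =
    ∑ᶠ k : ℕ, Ring.choose m k • ((d : V →ₗ[F] V) ^ k) (B.coeff (n - m + k)) := rfl

theorem OrderLE.lshift {B : PseudoDiffOp d} {K : ℤ} (hB : B.OrderLE K) (m : ℤ) :
    (lshift m B).OrderLE (m + K) := fun n hn =>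
  finsum_eq_zero_of_forall_eq_zero fun k => by rw [hB _ (by omega), map_zero, smul_zero]

theorem coeff_mul_aux (A B : PseudoDiffOp d) (n : ℤ) : (A * B).coeff n =
    ∑ᶠ x : ℤ × ℕ, Ring.choose x.1 x.2 •
        (A.coeff x.1 * ((d : V →ₗ[F] V) ^ x.2) (B.coeff (n - x.1 + x.2))) := rfl

theorem coeff_mul (A B : PseudoDiffOp d) (n : ℤ) :
    (A * B).coeff n = ∑ᶠ m : ℤ, A.coeff m * (lshift m B).coeff n := by
  rw [coeff_mul_aux, finsum_curry _ (finite_support_mul A B n)]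
  refine finsum_congr fun m => ?_
  rw [coeff_lshift, mul_finsum' _ _ (finite_support_lshift m B n)]
  exact finsum_congr fun k => (mul_smul_comm _ _ _).symm

theorem finite_support_coeff_mul (A B : PseudoDiffOp d) (n : ℤ) :
    (Function.support fun m : ℤ => A.coeff m * (lshift m B).coeff n).Finite := by
  obtain ⟨N, hN⟩ := A.coeff_bounded
  obtain ⟨K, hK⟩ := B.coeff_bounded
  refine finite_support_of_bounded (n - K) N (fun m hm => ?_) fun m hm => ?_
  · rw [OrderLE.lshift hK m n (by omega), mul_zero]
  · rw [hN m hm, zero_mul]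

theorem OrderLE.mul {A B : PseudoDiffOp d} {N K : ℤ} (hA : A.OrderLE N) (hB : B.OrderLE K) :
    (A * B).OrderLE (N + K) := fun n hn => by
  rw [coeff_mul]
  refine finsum_eq_zero_of_forall_eq_zero fun m => ?_
  rcases lt_or_ge N m with h | h
  · rw [hA m h, zero_mul]
  · rw [hB.lshift m n (by omega), mul_zero]

theorem add_mul_aux (A B C : PseudoDiffOp d) : (A + B) * C = A * C + B * C := by
  ext n
  simp only [coeff_mul, coeff_add, add_mul]
  exact finsum_add_distrib (finite_support_coeff_mul A C n) (finite_support_coeff_mul B C n)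

theorem mul_add_aux (A B C : PseudoDiffOp d) : A * (B + C) = A * B + A * C := by
  ext n
  simp only [coeff_mul, coeff_add, map_add, mul_add]
  exact finsum_add_distrib (finite_support_coeff_mul A B n) (finite_support_coeff_mul A C n)

theorem coeff_mono_mul (m : ℤ) (a : V) (B : PseudoDiffOp d) (n : ℤ) :
    (mono d m a * B).coeff n = a * (lshift m B).coeff n := by
  rw [coeff_mul, finsum_eq_single _ m fun k hk => by rw [coeff_mono, if_neg hk, zero_mul],
    coeff_mono, if_pos rfl]

theorem lshift_zero (B : PseudoDiffOp d) : lshift 0 B = B := by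
  ext n
  rw [coeff_lshift, finsum_eq_single _ 0 fun k hk => by
    rw [Ring.choose_zero_pos ℤ (Nat.pos_of_ne_zero hk), zero_smul]]
  simp

theorem coeff_lshift_one (B : PseudoDiffOp d) (n : ℤ) :
    (lshift 1 B).coeff n = B.coeff (n - 1) + d (B.coeff n) := by
  rw [coeff_lshift, finsum_eq_sum_of_support_subset (s := {0, 1})]
  · simp
  · intro k hk
    by_contra h
    simp only [Finset.coe_insert, Finset.coe_singleton, Set.mem_insert_iff, Set.mem_singleton_iff]
      at h
    refine hk ?_
    have h1 : Ring.choose (1 : ℤ) k = 0 := by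
      have := Ring.choose_natCast (R := ℤ) 1 k
      rw [Nat.choose_eq_zero_of_lt (by omega)] at this
      simpa using this
    simp only [h1, zero_smul]

theorem map_lshift (m : ℤ) (B : PseudoDiffOp d) (n : ℤ) : d ((lshift m B).coeff n) =
    ∑ᶠ k : ℕ, Ring.choose m k • ((d : V →ₗ[F] V) ^ (k + 1)) (B.coeff (n - m + k)) := by
  rw [coeff_lshift]
  refine (AddMonoidHom.map_finsum (d : V →ₗ[F] V).toAddMonoidHom
    (finite_support_lshift m B n)).trans (finsum_congr fun k => ?_)
  rw [pow_succ', Module.End.mul_apply]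
  exact map_zsmul (d : V →ₗ[F] V) _ _

/-- Pascal's rule for binomials with integer upper argument. -/
theorem lshift_one_lshift (m : ℤ) (B : PseudoDiffOp d) :
    lshift 1 (lshift m B) = lshift (m + 1) B := by
  ext n
  obtain ⟨K, hK⟩ := B.coeff_bounded
  rw [coeff_lshift_one, map_lshift, coeff_lshift, coeff_lshift]
  have h1 : ∀ k : ℕ, n - m + k = n - (m + 1) + (k + 1 : ℕ) := fun k => by push_cast; ring
  rw [finsum_nat_eq_add (f := fun k : ℕ => Ring.choose (m + 1) k •
      ((d : V →ₗ[F] V) ^ k) (B.coeff (n - (m + 1) + k))) (finite_support_lshift (m + 1) B n),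
    finsum_nat_eq_add (f := fun k : ℕ => Ring.choose m k •
      ((d : V →ₗ[F] V) ^ k) (B.coeff (n - 1 - m + k))) (finite_support_lshift m B (n - 1)),
    add_assoc, ← finsum_add_distrib]
  · congr 1
    · simp only [Ring.choose_zero_right]
      rw [show n - 1 - m = n - (m + 1) by ring]
    · refine finsum_congr fun k => ?_
      rw [Ring.choose_succ_succ, add_smul, h1, add_comm, show n - 1 - m = n - (m + 1) by ring]
  · exact finite_support_of_bounded_nat (K - n + m) fun k hk => by
      rw [hK _ (by push_cast; omega), map_zero, smul_zero]
  · exact finite_support_of_bounded_nat (K - n + m) fun k hk => by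
      rw [hK _ (by omega), map_zero, smul_zero]

theorem lshift_lshift_one (m : ℤ) (B : PseudoDiffOp d) :
    lshift m (lshift 1 B) = lshift (m + 1) B := by
  rw [← lshift_one_lshift]
  ext n
  obtain ⟨K, hK⟩ := B.coeff_bounded
  rw [coeff_lshift_one, map_lshift, coeff_lshift, coeff_lshift, ← finsum_add_distrib]
  · refine finsum_congr fun k => ?_
    rw [coeff_lshift_one, map_add, smul_add, pow_succ, Module.End.mul_apply,
      show n - m + k - 1 = n - 1 - m + k by ring]
    rfl
  · exact finite_support_lshift m B (n - 1)
  · exact finite_support_of_bounded_nat (K - n + m) fun k hk => by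
      rw [hK _ (by omega), map_zero, smul_zero]

theorem lshift_lshift (m n : ℤ) (B : PseudoDiffOp d) :
    lshift m (lshift n B) = lshift (m + n) B := by
  induction m generalizing n B with
  | zero => rw [lshift_zero, zero_add]
  | succ m ih => rw [← lshift_one_lshift, ih, lshift_one_lshift]; congr 2; ring
  | pred m ih =>
    -- `∂` is invertible on the left, so a negative power can be compared after multiplying by `∂`.
    have h : ∀ C : PseudoDiffOp d, lshift (-1) (lshift 1 C) = C := fun C => by
      rw [lshift_lshift_one, neg_add_cancel, lshift_zero]
    rw [← h (lshift (-m - 1) _), lshift_one_lshift, sub_add_cancel, ih,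
      ← h (lshift (-m - 1 + n) _), lshift_one_lshift]
    congr 3; ring

theorem coeff_mono_zero_mul (a : V) (B : PseudoDiffOp d) (n : ℤ) :
    (mono d 0 a * B).coeff n = a * B.coeff n := by
  rw [coeff_mono_mul, lshift_zero]

/-- For `B = b ∂^m` this is the Leibniz rule for `d`; the general case follows one coefficient at a
time. The threshold `n - K - 2` leaves room for the extra `∂`. -/
theorem lshift_one_mul (B C : PseudoDiffOp d) : lshift 1 B * C = lshift 1 (B * C) := by
  ext n
  obtain ⟨K, hK⟩ := C.coeff_bounded
  revert B
  refine order_induction (fun A B hA hB => ?_) (n - K - 2) (fun B hB => ?_) (mono d)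
    (fun m a => by rw [sub_self]; exact fun _ _ => rfl) fun m b => ?_
  · rw [map_add, add_mul_aux, add_mul_aux, map_add, coeff_add, hA, hB, coeff_add]
  · rw [(hB.lshift 1).mul hK n (by omega), (hB.mul hK).lshift 1 n (by omega)]
  · have h : lshift 1 (mono d m b) = mono d (m + 1) b + mono d m (d b) := by
      ext n
      rw [coeff_lshift_one, coeff_add, coeff_mono, coeff_mono, coeff_mono, coeff_mono]
      congr 1
      · simp only [sub_eq_iff_eq_add]
      · split_ifs <;> simp
    rw [h, add_mul_aux, coeff_add, coeff_lshift_one]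
    simp only [coeff_mono_mul]
    rw [← lshift_one_lshift, coeff_lshift_one, Derivation.leibniz]
    simp only [smul_eq_mul]
    ring

theorem lshift_mul (m : ℤ) (B C : PseudoDiffOp d) : lshift m B * C = lshift m (B * C) := by
  have hinj : ∀ {X Y : PseudoDiffOp d}, lshift 1 X = lshift 1 Y → X = Y := fun {X Y} h => by
    rw [← lshift_zero X, ← lshift_zero Y, ← neg_add_cancel 1, ← lshift_lshift, h, lshift_lshift]
  induction m with
  | zero => rw [lshift_zero, lshift_zero]
  | succ m ih => rw [← lshift_one_lshift, lshift_one_mul, ih, lshift_one_lshift]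
  | pred m ih =>
    refine hinj ?_
    rw [← lshift_one_mul, lshift_one_lshift, lshift_one_lshift, sub_add_cancel, ih]

theorem mono_mul_mul (m : ℤ) (a : V) (B C : PseudoDiffOp d) :
    mono d m a * B * C = mono d m a * (B * C) := by
  ext n
  rw [coeff_mono_mul, ← lshift_mul, coeff_mul, coeff_mul,
    mul_finsum' _ _ (finite_support_coeff_mul _ C n)]
  exact finsum_congr fun k => by rw [coeff_mono_mul, mul_assoc]

/-- A fixed coefficient of either side does not see terms of `A` of very low order, and `A = a ∂^m`
reduces to `lshift_mul`. -/
theorem mul_assoc_aux (A B C : PseudoDiffOp d) : A * B * C = A * (B * C) := by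
  ext n
  obtain ⟨K, hK⟩ := B.coeff_bounded
  obtain ⟨L, hL⟩ := C.coeff_bounded
  revert A
  refine order_induction (fun X Y hX hY => ?_) (n - K - L - 1) (fun A hA => ?_) (mono d)
    (fun m a => by rw [sub_self]; exact fun _ _ => rfl) fun m b => ?_
  · rw [add_mul_aux, add_mul_aux, coeff_add, hX, hY, add_mul_aux, coeff_add]
  · rw [(hA.mul hK).mul hL n (by omega), hA.mul (OrderLE.mul hK hL) n (by omega)]
  · rw [mono_mul_mul]

theorem one_mul_aux (A : PseudoDiffOp d) : 1 * A = A := by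
  ext n
  rw [one_eq_mono, coeff_mono_mul, lshift_zero, one_mul]

theorem iterate_map_one (k : ℕ) : ((d : V →ₗ[F] V) ^ (k + 1)) 1 = 0 := by
  rw [pow_succ, Module.End.mul_apply]
  simp

theorem lshift_one_eq_mono (m : ℤ) : lshift m (1 : PseudoDiffOp d) = mono d m 1 := by
  ext n
  rw [coeff_lshift, finsum_eq_single _ 0, one_eq_mono, coeff_mono, coeff_mono]
  · simp [sub_eq_zero]
  · intro k hk
    obtain ⟨k, rfl⟩ := Nat.exists_eq_succ_of_ne_zero hk
    rw [one_eq_mono, coeff_mono]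
    split_ifs
    · rw [iterate_map_one, smul_zero]
    · rw [map_zero, smul_zero]

theorem mul_one_aux (A : PseudoDiffOp d) : A * 1 = A := by
  ext n
  rw [coeff_mul, finsum_eq_single _ n, lshift_one_eq_mono, coeff_mono, if_pos rfl, mul_one]
  intro m hm
  rw [lshift_one_eq_mono, coeff_mono, if_neg hm.symm, mul_zero]

instance : Ring (PseudoDiffOp d) where
  __ := (inferInstance : AddCommGroup (PseudoDiffOp d))
  mul := (· * ·)
  one := 1
  left_distrib := mul_add_aux
  right_distrib := add_mul_aux
  zero_mul A := by simpa using add_mul_aux 0 0 A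
  mul_zero A := by simpa using mul_add_aux A 0 0
  mul_assoc := mul_assoc_aux
  one_mul := one_mul_aux
  mul_one := mul_one_aux

theorem mono_one_mul (m : ℤ) (B : PseudoDiffOp d) : mono d m 1 * B = lshift m B := by
  ext n
  rw [coeff_mono_mul, one_mul]

end PseudoDiffOp

end

/-! ### Residues, change of coefficients and the pairing -/

section

namespace PseudoDiffOp

section Monomials

variable {F V : Type*} [Field F] [CommRing V] [Algebra F V] {d : Derivation F V V}

theorem mono_one_mul_mono_one (m r : ℤ) : mono d m 1 * mono d r 1 = mono d (m + r) 1 := by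
  rw [mono_one_mul, ← lshift_one_eq_mono, lshift_lshift, lshift_one_eq_mono]

theorem mono_mul_mono_one (m r : ℤ) (a : V) : mono d m a * mono d r 1 = mono d (m + r) a := by
  ext n
  rw [coeff_mono_mul, ← mono_one_mul, mono_one_mul_mono_one, coeff_mono, coeff_mono]
  split_ifs <;> simp

theorem mono_zero_one : mono d 0 1 = 1 := one_eq_mono.symm

theorem coeff_mul_mono_one (A : PseudoDiffOp d) (r n : ℤ) :
    (A * mono d r 1).coeff n = A.coeff (n - r) := by
  rw [coeff_mul, finsum_eq_single _ (n - r), ← mono_one_mul, mono_one_mul_mono_one, coeff_mono,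
    if_pos (by ring), mul_one]
  intro m hm
  rw [← mono_one_mul, mono_one_mul_mono_one, coeff_mono, if_neg (by omega), mul_zero]

theorem coeff_lshift_mono (m r : ℤ) (a : V) (n : ℤ) (k : ℕ) (h : n + k = m + r) :
    (lshift m (mono d r a)).coeff n = Ring.choose m k • ((d : V →ₗ[F] V) ^ k) a := by
  rw [coeff_lshift, finsum_eq_single _ k, coeff_mono, if_pos (by omega)]
  intro l hl
  rw [coeff_mono, if_neg (by omega), map_zero, smul_zero]

theorem choose_eq_zero_of_lt {m : ℤ} {k : ℕ} (h0 : 0 ≤ m) (h : m < k) : Ring.choose m k = 0 := by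
  lift m to ℕ using h0
  rw [Ring.choose_natCast, Nat.choose_eq_zero_of_lt (by omega), Nat.cast_zero]

/-- The residue of `∂^m ∘ a`. -/
theorem res_lshift_mono_zero (m : ℤ) (a : V) :
    (lshift m (mono d 0 a)).coeff (-1) = if m = -1 then a else 0 := by
  split_ifs with h
  · rw [coeff_lshift_mono m 0 a (-1) 0 (by simp [h])]
    simp
  · rcases lt_or_ge m 0 with h1 | h1
    -- For `m < -1` the order is too low; for `m ≥ 0` the operator is differential, because
    -- `binom(m, m + 1) = 0`.
    · exact (mono_orderLE 0 a).lshift m (-1) (by omega)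
    · rw [coeff_lshift_mono m 0 a (-1) (m + 1).toNat (by omega),
        choose_eq_zero_of_lt h1 (by omega), zero_smul]

theorem res_mul_mono_zero (A : PseudoDiffOp d) (a : V) :
    (A * mono d 0 a).coeff (-1) = a * A.coeff (-1) := by
  rw [coeff_mul, finsum_eq_single _ (-1), res_lshift_mono_zero, if_pos rfl, mul_comm]
  intro m hm
  rw [res_lshift_mono_zero, if_neg hm, mul_zero]

end Monomials

variable {F V W : Type*} [Field F] [CommRing V] [Algebra F V] [CommRing W] [Algebra F W]
  {d : Derivation F V V} {e : Derivation F W W}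

/-- The operator obtained by applying an additive map to all coefficients. -/
def mapCoeff (e : Derivation F W W) (g : V →+ W) : PseudoDiffOp d →+ PseudoDiffOp e where
  toFun A := ⟨fun n => g (A.coeff n), by
    obtain ⟨N, hN⟩ := A.coeff_bounded
    exact ⟨N, fun n hn => (congrArg g (hN n hn)).trans (map_zero g)⟩⟩
  map_zero' := ext fun _ => map_zero g
  map_add' _ _ := ext fun _ => map_add g _ _

@[simp] theorem coeff_mapCoeff (g : V →+ W) (A : PseudoDiffOp d) (n : ℤ) :
    (mapCoeff e g A).coeff n = g (A.coeff n) := rfl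

theorem map_pow_of_comm {g : V →+ W} (hg : ∀ a, g (d a) = e (g a)) (k : ℕ) (a : V) :
    g (((d : V →ₗ[F] V) ^ k) a) = ((e : W →ₗ[F] W) ^ k) (g a) := by
  induction k with
  | zero => rfl
  | succ k ih =>
    rw [pow_succ', pow_succ', Module.End.mul_apply, Module.End.mul_apply, ← ih]
    exact hg _

theorem mapCoeff_lshift {g : V →+ W} (hg : ∀ a, g (d a) = e (g a)) (m : ℤ) (A : PseudoDiffOp d) :
    mapCoeff e g (lshift m A) = lshift m (mapCoeff e g A) := by
  ext n
  rw [coeff_mapCoeff, coeff_lshift, coeff_lshift, g.map_finsum (finite_support_lshift m A n)]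
  exact finsum_congr fun k => by rw [map_zsmul, map_pow_of_comm hg, coeff_mapCoeff]

/-- Extension of scalars along a homomorphism of differential algebras. -/
def extend [Algebra V W] (h : ∀ a, e (algebraMap V W a) = algebraMap V W (d a)) :
    PseudoDiffOp d →+* PseudoDiffOp e where
  toFun := mapCoeff e (algebraMap V W : V →+ W)
  map_zero' := map_zero _
  map_add' := map_add _
  map_one' := by
    ext n
    rw [coeff_mapCoeff, one_eq_mono, one_eq_mono, coeff_mono, coeff_mono]
    split_ifs <;> simp
  map_mul' A B := by
    ext n
    rw [coeff_mapCoeff, coeff_mul, coeff_mul, AddMonoidHom.map_finsum _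
      (finite_support_coeff_mul A B n)]
    refine finsum_congr fun m => ?_
    rw [← mapCoeff_lshift (fun a => (h a).symm)]
    exact map_mul (algebraMap V W) _ _

section Extend

variable [Algebra V W]
  (h : ∀ a, e (algebraMap V W a) = algebraMap V W (d a))

@[simp] theorem coeff_extend (A : PseudoDiffOp d) (n : ℤ) :
    (extend h A).coeff n = algebraMap V W (A.coeff n) := rfl

theorem extend_mono (m : ℤ) (a : V) :
    extend h (mono d m a) = mono e m (algebraMap V W a) := by
  ext n
  rw [coeff_extend, coeff_mono, coeff_mono]
  split_ifs <;> simp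

theorem OrderLE.extend {A : PseudoDiffOp d} {N : ℤ} (hA : A.OrderLE N) :
    (extend h A).OrderLE N := fun n hn => by rw [coeff_extend, hA n hn, map_zero]

/-- Because `δ` intertwines `d` and `e`, it passes through left multiplication by `∂^m`; only the
product rule on coefficients remains. -/
theorem mapCoeff_mul (δ : Derivation F V W)
    (hδ : ∀ a, δ (d a) = e (δ a)) (A B : PseudoDiffOp d) :
    mapCoeff e (δ : V →ₗ[F] W).toAddMonoidHom (A * B) =
      mapCoeff e (δ : V →ₗ[F] W).toAddMonoidHom A * extend h B +
        extend h A * mapCoeff e (δ : V →ₗ[F] W).toAddMonoidHom B := by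
  ext n
  rw [coeff_mapCoeff, coeff_mul, coeff_add, coeff_mul, coeff_mul, AddMonoidHom.map_finsum _
      (finite_support_coeff_mul A B n), ← finsum_add_distrib (finite_support_coeff_mul _ _ n)
      (finite_support_coeff_mul _ _ n)]
  refine finsum_congr fun m => ?_
  rw [← mapCoeff_lshift (g := (δ : V →ₗ[F] W).toAddMonoidHom) hδ]
  have h1 : lshift m (extend h B) = extend h (lshift m B) :=
    (mapCoeff_lshift (fun a => (h a).symm) m B).symm
  rw [h1]
  refine (Derivation.leibniz δ _ _).trans ?_
  rw [Algebra.smul_def, Algebra.smul_def, add_comm, mul_comm]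
  rfl

end Extend

/-! ### The pairing of operators with a bilinear map in place of `f da` -/

section Pairing

variable {G : Type*} [AddCommGroup G]

/-- The analogue of `∫ Res (P ∘ dA)`, for an additive map `Δ a f` in place of `∫ f da`. -/
def pairing (Δ : V →+ W →+ G) (P : PseudoDiffOp e) (A : PseudoDiffOp d) : G :=
  ∑ᶠ n : ℤ, Δ (A.coeff n) ((lshift n P).coeff (-1))

theorem finite_support_pairing (Δ : V →+ W →+ G) (P : PseudoDiffOp e) (A : PseudoDiffOp d) :
    (Function.support fun n : ℤ => Δ (A.coeff n) ((lshift n P).coeff (-1))).Finite := by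
  obtain ⟨N, hN⟩ := A.coeff_bounded
  obtain ⟨K, hK⟩ := P.coeff_bounded
  refine finite_support_of_bounded (-1 - K) N (fun m hm => ?_) fun m hm => ?_
  · rw [OrderLE.lshift hK m _ (by omega), map_zero]
  · rw [hN m hm, map_zero, AddMonoidHom.zero_apply]

variable (Δ : V →+ W →+ G)

theorem pairing_add_left (P Q : PseudoDiffOp e) (A : PseudoDiffOp d) :
    pairing Δ (P + Q) A = pairing Δ P A + pairing Δ Q A := by
  rw [pairing, pairing, pairing, ← finsum_add_distrib (finite_support_pairing Δ P A)
    (finite_support_pairing Δ Q A)]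
  exact finsum_congr fun n => by rw [map_add, coeff_add, map_add]

theorem pairing_add_right (P : PseudoDiffOp e) (A B : PseudoDiffOp d) :
    pairing Δ P (A + B) = pairing Δ P A + pairing Δ P B := by
  rw [pairing, pairing, pairing, ← finsum_add_distrib (finite_support_pairing Δ P A)
    (finite_support_pairing Δ P B)]
  exact finsum_congr fun n => by rw [coeff_add, map_add, AddMonoidHom.add_apply]

/-- The pairing as an additive map of both arguments. -/
def pairingHom (e : Derivation F W W) (d : Derivation F V V) :
    PseudoDiffOp e →+ PseudoDiffOp d →+ G :=
  AddMonoidHom.mk' (fun P => AddMonoidHom.mk' (pairing Δ P) (pairing_add_right Δ P))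
    fun P Q => AddMonoidHom.ext fun A => pairing_add_left Δ P Q A

@[simp] theorem pairingHom_apply (P : PseudoDiffOp e) (A : PseudoDiffOp d) :
    pairingHom Δ e d P A = pairing Δ P A := rfl

theorem pairing_eq_zero {P : PseudoDiffOp e} {A : PseudoDiffOp d} {N K : ℤ} (hP : P.OrderLE K)
    (hA : A.OrderLE N) (hNK : N + K < -1) : pairing Δ P A = 0 :=
  finsum_eq_zero_of_forall_eq_zero fun n => by
    rcases lt_or_ge N n with h | h
    · rw [hA n h, map_zero, AddMonoidHom.zero_apply]
    · rw [hP.lshift n _ (by omega), map_zero]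

theorem pairing_mono (P : PseudoDiffOp e) (m : ℤ) (a : V) :
    pairing Δ P (mono d m a) = Δ a ((lshift m P).coeff (-1)) := by
  rw [pairing, finsum_eq_single _ m, coeff_mono, if_pos rfl]
  intro n hn
  rw [coeff_mono, if_neg hn, map_zero, AddMonoidHom.zero_apply]

variable {Δ}

/-- Integration by parts: after an index shift, the derivative in `Res (∂^{n+1} P)` cancels the one
that `hd` moves off `d (b_n)`, leaving `Res (∂^n P ∂)`. -/
theorem pairing_mono_one_mul (hd : ∀ a f, Δ (d a) f = -Δ a (e f)) (P : PseudoDiffOp e)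
    (B : PseudoDiffOp d) : pairing Δ P (mono d 1 1 * B) = pairing Δ (P * mono e 1 1) B := by
  obtain ⟨N, hN⟩ := B.coeff_bounded
  obtain ⟨K, hK⟩ := P.coeff_bounded
  have h1 : ∀ n < -1 - K, (lshift n P).coeff (-1) = 0 := fun n hn =>
    OrderLE.lshift hK n _ (by omega)
  have hfin := finite_support_pairing Δ P B
  rw [mono_one_mul, pairing]
  simp only [coeff_lshift_one, map_add, AddMonoidHom.add_apply]
  rw [finsum_add_distrib, ← finsum_comp_equiv (Equiv.addRight (1 : ℤ)), ← finsum_add_distrib,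
    pairing]
  · refine finsum_congr fun n => ?_
    rw [hd, ← lshift_mul, coeff_mul_mono_one, Equiv.coe_addRight, add_sub_cancel_right,
      ← lshift_one_lshift, coeff_lshift_one, map_add]
    simp
  · refine finite_support_of_bounded (-2 - K) N (fun m hm => ?_) fun m hm => ?_
    · rw [Equiv.coe_addRight, h1 (m + 1) (by omega), map_zero]
    · rw [Equiv.coe_addRight, hN (m + 1 - 1) (by omega), map_zero, AddMonoidHom.zero_apply]
  · refine finite_support_of_bounded (-2 - K) N (fun m hm => ?_) fun m hm => ?_
    · rw [h1 _ (by omega), map_zero]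
    · rw [hN _ (by omega), map_zero, map_zero, AddMonoidHom.zero_apply]
  · refine finite_support_of_bounded (-2 - K) (N + 1) (fun m hm => ?_) fun m hm => ?_
    · rw [h1 _ (by omega), map_zero]
    · rw [hN _ (by omega), map_zero, AddMonoidHom.zero_apply]
  · refine finite_support_of_bounded (-2 - K) (N + 1) (fun m hm => ?_) fun m hm => ?_
    · rw [h1 _ (by omega), map_zero]
    · rw [hN _ (by omega), map_zero, map_zero, AddMonoidHom.zero_apply]

theorem pairing_mono_one_mul_int (hd : ∀ a f, Δ (d a) f = -Δ a (e f)) (m : ℤ)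
    (P : PseudoDiffOp e) (B : PseudoDiffOp d) :
    pairing Δ P (mono d m 1 * B) = pairing Δ (P * mono e m 1) B := by
  induction m generalizing P with
  | zero => rw [mono_zero_one, mono_zero_one, one_mul, mul_one]
  | succ m ih =>
    rw [add_comm, ← mono_one_mul_mono_one, mul_assoc, pairing_mono_one_mul hd, ih, mul_assoc,
      mono_one_mul_mono_one]
  | pred m ih =>
    have h1 := pairing_mono_one_mul hd (P * mono e (-1) 1) (mono d (-m - 1) 1 * B)
    rw [← mul_assoc (mono d 1 1), mono_one_mul_mono_one, add_sub_cancel, ih, mul_assoc P,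
      mul_assoc P, mono_one_mul_mono_one, mono_one_mul_mono_one, neg_add_cancel, mono_zero_one,
      mul_one] at h1
    rw [← h1]
    congr 3
    ring

variable [Algebra V W]

theorem map_one_eq_zero
    (hmul : ∀ a b f, Δ (a * b) f = Δ a (algebraMap V W b * f) + Δ b (algebraMap V W a * f))
    (f : W) : Δ 1 f = 0 := by
  have := hmul 1 1 f
  simpa using this

variable (h : ∀ a, e (algebraMap V W a) = algebraMap V W (d a))

/-- Termwise, `hmul` splits `Δ (a b_n)`; the identity `Res (Q ∘ a) = a Res Q` identifies the part
that differentiates `b_n`. -/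
theorem pairing_mono_zero_mul
    (hmul : ∀ a b f, Δ (a * b) f = Δ a (algebraMap V W b * f) + Δ b (algebraMap V W a * f)) (P : PseudoDiffOp e) (a : V) (B : PseudoDiffOp d) :
    pairing Δ P (mono d 0 a * B) =
      pairing Δ (extend h B * P) (mono d 0 a) + pairing Δ (P * extend h (mono d 0 a)) B := by
  have hfin := finite_support_coeff_mul (extend h B) P (-1)
  rw [pairing_mono, lshift_zero, coeff_mul, (Δ a).map_finsum hfin, pairing, pairing,
    ← finsum_add_distrib _ (finite_support_pairing Δ _ B)]
  · refine finsum_congr fun n => ?_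
    rw [coeff_mono_mul, lshift_zero, hmul, ← lshift_mul, extend_mono, res_mul_mono_zero]
    rfl
  · refine hfin.subset fun n hn h0 => hn ?_
    simp only at h0
    simp only [h0, map_zero]

/-- The Leibniz rule and the cyclicity of the pairing. -/
theorem pairing_mul
    (hmul : ∀ a b f, Δ (a * b) f = Δ a (algebraMap V W b * f) + Δ b (algebraMap V W a * f))
    (hd : ∀ a f, Δ (d a) f = -Δ a (e f)) (P : PseudoDiffOp e) (A B : PseudoDiffOp d) :
    pairing Δ P (A * B) = pairing Δ (extend h B * P) A + pairing Δ (P * extend h A) B := by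
  obtain ⟨K, hK⟩ := P.coeff_bounded
  obtain ⟨N, hN⟩ := B.coeff_bounded
  have hK : P.OrderLE K := hK
  have hN : B.OrderLE N := hN
  revert A
  refine order_induction (fun X Y hX hY => ?_) (-2 - N - K) (fun A hA => ?_) (mono d)
    (fun m a => by rw [sub_self]; exact fun _ _ => rfl) fun m b => ?_
  · rw [add_mul, pairing_add_right, pairing_add_right, map_add, mul_add, pairing_add_left, hX, hY]
    abel
  · rw [pairing_eq_zero Δ hK (hA.mul hN) (by omega),
      pairing_eq_zero Δ ((hN.extend h).mul hK) hA (by omega),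
      pairing_eq_zero Δ (hK.mul (hA.extend h)) hN (by omega), add_zero]
  -- Factor `b ∂^m = b ∘ ∂^m` and move the two factors across separately. The pairing with `∂^m`
  -- itself vanishes since `Δ 1 = 0`.
  · have h1 : mono d m b = mono d 0 b * mono d m 1 := by rw [mono_mul_mono_one, zero_add]
    have h2 : ∀ Q : PseudoDiffOp e, pairing Δ Q (mono d m 1) = 0 := fun Q => by
      rw [pairing_mono, map_one_eq_zero hmul]
    rw [h1, mul_assoc, pairing_mono_zero_mul h hmul, pairing_mono_one_mul_int hd,
      pairing_mono_zero_mul h hmul (extend h B * P), h2, add_zero, map_mul, map_mul,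
      extend_mono h m 1, map_one, ← mul_assoc]
    simp only [mul_assoc]

end Pairing

end PseudoDiffOp

end

/-! ### Differential parts and the Adler kernel with `λ` acting as `∂` -/

section

theorem finsum_comp_of_support_subset_range {α β M : Type*} [AddCommMonoid M] {g : α → β}
    (hg : Function.Injective g) (f : β → M) (hf : ∀ b, b ∉ Set.range g → f b = 0) :
    ∑ᶠ b, f b = ∑ᶠ a, f (g a) := by
  rw [← finsum_mem_range hg, ← finsum_mem_univ]
  refine finsum_mem_inter_support_eq' f _ _ fun x hx => ?_
  simp only [Set.mem_univ, true_iff]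
  by_contra h
  exact hx (hf x h)

theorem finsum_int_eq_finsum_add {M : Type*} [AddCommMonoid M] (f : ℤ → M) (a : ℤ)
    (hf : ∀ n < a, f n = 0) : ∑ᶠ n, f n = ∑ᶠ k : ℕ, f (a + k) :=
  finsum_comp_of_support_subset_range (fun k l hkl => by simpa using hkl) f fun n hn =>
    hf n (by
      by_contra h
      exact hn ⟨(n - a).toNat, by simp only; omega⟩)

theorem finsum_int_eq_finsum_sub {M : Type*} [AddCommMonoid M] (f : ℤ → M) (a : ℤ)
    (hf : ∀ n, a < n → f n = 0) : ∑ᶠ n, f n = ∑ᶠ k : ℕ, f (a - k) :=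
  finsum_comp_of_support_subset_range (fun k l hkl => by simpa using hkl) f fun n hn =>
    hf n (by
      by_contra h
      exact hn ⟨(a - n).toNat, by simp only; omega⟩)

namespace PseudoDiffOp

section Plus

variable {F V : Type*} [Field F] [CommRing V] [Algebra F V] {d : Derivation F V V}

/-- The differential part of an operator. -/
def plus : PseudoDiffOp d →+ PseudoDiffOp d where
  toFun A := ⟨fun n => if 0 ≤ n then A.coeff n else 0, by
    obtain ⟨N, hN⟩ := A.coeff_bounded
    refine ⟨N, fun n hn => ?_⟩
    change (if 0 ≤ n then A.coeff n else 0) = 0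
    rw [hN n hn, ite_self]⟩
  map_zero' := ext fun n => by
    change (if 0 ≤ n then (0 : V) else 0) = 0
    rw [ite_self]
  map_add' A B := ext fun n => by
    change (if 0 ≤ n then (A + B).coeff n else 0) =
      (if 0 ≤ n then A.coeff n else 0) + if 0 ≤ n then B.coeff n else 0
    split_ifs <;> simp

theorem coeff_plus (A : PseudoDiffOp d) (n : ℤ) :
    (plus A).coeff n = if 0 ≤ n then A.coeff n else 0 := rfl

theorem OrderLE.plus_eq_zero {A : PseudoDiffOp d} {N : ℤ} (hA : A.OrderLE N) (hN : N < 0) :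
    PseudoDiffOp.plus A = 0 := ext fun n => by
  rw [coeff_plus]
  split_ifs
  · exact hA n (by omega)
  · rfl

theorem mono_zero_zero : mono d 0 0 = 0 := ext fun n => by
  rw [coeff_mono, ite_self, coeff_zero]

theorem plus_mono_zero_mul (a : V) (A : PseudoDiffOp d) :
    plus (mono d 0 a * A) = mono d 0 a * plus A := by
  ext n
  rw [coeff_mono_zero_mul, coeff_plus, coeff_plus, coeff_mono_zero_mul]
  split_ifs <;> simp

/-- Multiplication by a function on the right preserves both differential operators and operators of
negative order. -/
theorem plus_mul_mono_zero (A : PseudoDiffOp d) (a : V) :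
    plus (A * mono d 0 a) = plus A * mono d 0 a := by
  ext n
  rw [coeff_plus, coeff_mul, coeff_mul]
  split_ifs with hn
  · refine finsum_congr fun m => ?_
    rw [coeff_plus]
    split_ifs with hm
    · rfl
    · rw [(mono_orderLE 0 a).lshift m n (by omega), mul_zero, zero_mul]
  · refine (finsum_eq_zero_of_forall_eq_zero fun m => ?_).symm
    rw [coeff_plus]
    split_ifs with hm
    · rw [coeff_lshift_mono m 0 a n (m - n).toNat (by omega), choose_eq_zero_of_lt hm (by omega),
        zero_smul, mul_zero]
    · rw [zero_mul]

theorem lshift_mono_zero_sub_orderLE (m : ℤ) (a : V) :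
    (lshift m (mono d 0 a) - mono d m a).OrderLE (m - 1) := fun n hn => by
  rw [coeff_sub, coeff_mono]
  split_ifs with h
  · rw [coeff_lshift_mono m 0 a n 0 (by simp [h])]
    simp
  · rw [(mono_orderLE 0 a).lshift m n (by omega), sub_zero]

theorem plus_lshift_mono_zero (m : ℤ) (a : V) :
    plus (lshift m (mono d 0 a)) = if 0 ≤ m then lshift m (mono d 0 a) else 0 := by
  split_ifs with hm
  · ext n
    rw [coeff_plus]
    split_ifs with hn
    · rfl
    · rw [coeff_lshift_mono m 0 a n (m - n).toNat (by omega), choose_eq_zero_of_lt hm (by omega),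
        zero_smul]
  · exact ((mono_orderLE 0 a).lshift m).plus_eq_zero (by omega)

theorem coeff_mul_lshift_mono_zero (B : PseudoDiffOp d) (p : ℤ) (a : V) (s : ℤ) :
    (B * lshift p (mono d 0 a)).coeff s = ∑ᶠ q : ℕ, Ring.choose (s + q) q •
      (B.coeff (s + q - p) * ((d : V →ₗ[F] V) ^ q) a) := by
  rw [coeff_mul, finsum_int_eq_finsum_add _ (s - p)]
  · refine finsum_congr fun q => ?_
    rw [lshift_lshift, coeff_lshift_mono _ 0 a s q (by ring), mul_smul_comm,
      show s - p + (q : ℤ) + p = s + q by ring, show s - p + (q : ℤ) = s + q - p by ring]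
  · intro n hn
    rw [lshift_lshift, (mono_orderLE 0 a).lshift _ s (by omega), mul_zero]

/-- The expansion of the differential part of `A` with coefficients on the right. -/
theorem coeff_mul_plus (B A : PseudoDiffOp d) (s : ℤ) : (B * plus A).coeff s =
    ∑ᶠ p : ℕ, (B * lshift p (mono d 0 ((lshift (-p - 1) A).coeff (-1)))).coeff s := by
  have hfin : ∀ X : PseudoDiffOp d, (Function.support fun p : ℕ =>
      (B * lshift p (mono d 0 ((lshift (-p - 1) X).coeff (-1)))).coeff s).Finite := fun X => by
    obtain ⟨K, hK⟩ := X.coeff_bounded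
    have hK : X.OrderLE K := hK
    refine finite_support_of_bounded_nat K fun p hp => ?_
    rw [hK.lshift (-p - 1) (-1) (by omega), mono_zero_zero, map_zero, mul_zero, coeff_zero]
  revert A
  -- The leading terms are taken as `∂^m ∘ a`, not `a ∂^m`: the residue of `∂^{-p-1} ∂^m ∘ a` is
  -- then `a` for `p = m` and 0 otherwise.
  refine order_induction (fun X Y hX hY => ?_) (-1) (fun A hA => ?_)
    (fun m a => lshift m (mono d 0 a)) lshift_mono_zero_sub_orderLE fun m b => ?_
  · rw [map_add, mul_add, coeff_add, hX, hY, ← finsum_add_distrib (hfin X) (hfin Y)]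
    refine finsum_congr fun p => ?_
    rw [map_add, coeff_add, mono_add, map_add, mul_add, coeff_add]
  · rw [hA.plus_eq_zero (by omega), mul_zero, coeff_zero]
    refine (finsum_eq_zero_of_forall_eq_zero fun p => ?_).symm
    rw [hA.lshift (-p - 1) (-1) (by omega), mono_zero_zero, map_zero, mul_zero, coeff_zero]
  · simp only [lshift_lshift, res_lshift_mono_zero]
    rw [plus_lshift_mono_zero]
    split_ifs with hm
    · lift m to ℕ using hm
      rw [finsum_eq_single _ m, if_pos (by ring)]
      intro p hp
      rw [if_neg (by omega), mono_zero_zero, map_zero, mul_zero, coeff_zero]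
    · rw [mul_zero, coeff_zero]
      refine (finsum_eq_zero_of_forall_eq_zero fun p => ?_).symm
      rw [if_neg (by omega), mono_zero_zero, map_zero, mul_zero, coeff_zero]

theorem coeff_plus_mul (B A : PseudoDiffOp d) (s : ℤ) : (plus B * A).coeff s =
    ∑ᶠ p : ℕ, B.coeff p * (lshift p A).coeff s := by
  rw [coeff_mul, finsum_int_eq_finsum_add _ 0]
  · refine finsum_congr fun p => ?_
    rw [zero_add, coeff_plus, if_pos (by omega)]
  · intro n hn
    rw [coeff_plus, if_neg (by omega), zero_mul]

/-- Upper negation of binomials turns the adjoint's coefficients into residues of `∂^{-n-1} A`, the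
form in which they meet the pairing. -/
theorem coeff_adjoint (A : PseudoDiffOp d) (n : ℤ) :
    A.adjoint.coeff n = (n.negOnePow : ℤ) • (lshift (-n - 1) A).coeff (-1) := by
  rw [coeff_lshift, smul_finsum' _ (finite_support_lshift _ A _)]
  refine finsum_congr fun k => ?_
  rw [show -n - 1 = -(n + 1) by ring, Ring.choose_neg, smul_smul, Int.negOnePow_add,
    show n + 1 + (k : ℤ) - 1 = n + k by ring, show -1 - -(n + 1) + (k : ℤ) = n + k by ring]
  congr 1
  simp only [Units.val_mul, Units.smul_def, smul_eq_mul]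
  ring

end Plus

variable {F V W : Type*} [Field F] [CommRing V] [CommRing W] [Algebra F W] [Algebra V W]
  (e : Derivation F W W)

/-- The action of `P(∂)` on `f`, for `P ∈ V[λ]`. -/
def applyOp (f : W) : V[X] →ₗ[V] W :=
  lsum fun n => LinearMap.toSpanSingleton V W (((e : W →ₗ[F] W) ^ n) f)

theorem applyOp_monomial (f : W) (n : ℕ) (a : V) :
    applyOp e f (monomial n a) = a • ((e : W →ₗ[F] W) ^ n) f := by
  simp [applyOp, lsum_apply]

theorem applyOp_C (f : W) (a : V) : applyOp e f (C a) = a • f :=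
  applyOp_monomial e f 0 a

theorem applyOp_C_mul (f : W) (a : V) (P : V[X]) : applyOp e f (C a * P) = a • applyOp e f P := by
  rw [← smul_eq_C_mul, map_smul]

theorem applyOp_add_left (f g : W) (P : V[X]) :
    applyOp e (f + g) P = applyOp e f P + applyOp e g P := by
  induction P using Polynomial.induction_on' with
  | add P Q hP hQ => rw [map_add, map_add, map_add, hP, hQ]; abel
  | monomial n a => simp only [applyOp_monomial, map_add, smul_add]

theorem applyOp_X_mul (f : W) (P : V[X]) : applyOp e f (X * P) = applyOp e (e f) P := by
  induction P using Polynomial.induction_on' with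
  | add P Q hP hQ => rw [mul_add, map_add, map_add, hP, hQ]
  | monomial n a =>
    rw [X_mul_monomial, applyOp_monomial, applyOp_monomial, pow_succ, Module.End.mul_apply]
    rfl

variable {e} [Algebra F V] {d : Derivation F V V}

theorem deriv_smul (h : ∀ a, e (algebraMap V W a) = algebraMap V W (d a))
    (a : V) (f : W) : e (a • f) = a • e f + d a • f := by
  rw [Algebra.smul_def (R := V) (A := W), Derivation.leibniz, h, smul_eq_mul, smul_eq_mul,
    Algebra.smul_def (R := V) (A := W), Algebra.smul_def (R := V) (A := W)]
  ring

theorem lamAdd_monomial (n : ℕ) (a : V) :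
    lamAdd d (monomial n a) = monomial (n + 1) a + monomial n (d a) := by
  simp [lamAdd, lsum_apply, X_mul_monomial]

theorem applyOp_lamAdd (h : ∀ a, e (algebraMap V W a) = algebraMap V W (d a))
    (f : W) (P : V[X]) : applyOp e f (lamAdd d P) = e (applyOp e f P) := by
  induction P using Polynomial.induction_on' with
  | add P Q hP hQ => simp only [map_add, hP, hQ]
  | monomial n a =>
    rw [lamAdd_monomial, map_add, applyOp_monomial, applyOp_monomial, applyOp_monomial,
      deriv_smul h, pow_succ', Module.End.mul_apply]
    rfl

theorem applyOp_lamAdd_pow (h : ∀ a, e (algebraMap V W a) = algebraMap V W (d a))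
    (f : W) (P : V[X]) (k : ℕ) :
    applyOp e f ((lamAdd d ^ k) P) = ((e : W →ₗ[F] W) ^ k) (applyOp e f P) := by
  induction k with
  | zero => rfl
  | succ k ih =>
    rw [pow_succ', pow_succ', Module.End.mul_apply, Module.End.mul_apply, ← ih,
      applyOp_lamAdd h]
    rfl

/-- With `λ` acting on `f` and the shift acting on `b`, `λ + ∂` is the total derivative of `b f`.
This turns the left Leibniz rule of the bracket into the hypothesis `hmul` of the pairing. -/
theorem applyOp_substApply (h : ∀ a, e (algebraMap V W a) = algebraMap V W (d a))
    (f : W) (P : V[X]) (b : V) :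
    applyOp e f (substApply d P b) = applyOp e (b • f) P := by
  simp only [substApply, Polynomial.sum, map_sum, applyOp_C_mul, applyOp_lamAdd_pow h, applyOp_C]
  simp [applyOp, lsum_apply, Polynomial.sum]

theorem applyOp_evalLamSub_adjoint (h : ∀ a, e (algebraMap V W a) = algebraMap V W (d a))
    (f : W) (A : PseudoDiffOp d) (r : ℤ) :
    applyOp e f (A.adjoint.evalLamSub r) =
      (lshift (-r - 1) (mono e 0 f * extend h A)).coeff (-1) := by
  rw [evalLamSub]
  refine ((applyOp e f).toAddMonoidHom.map_finsum (finite_support_evalLamSub _ r)).trans ?_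
  rw [← lshift_mul, coeff_mul, finsum_int_eq_finsum_sub _ (-r - 1)]
  · refine finsum_congr fun l => ?_
    rw [coeff_lshift_mono _ 0 f (-r - 1 - l) l (by ring), coeff_adjoint]
    change applyOp e f _ = _
    rw [map_zsmul, applyOp_monomial, show -r - 1 = -(r + 1) by ring, Ring.choose_neg,
      show r + 1 + (l : ℤ) - 1 = r + l by ring, show -(r + 1) - (l : ℤ) = -(r + l) - 1 by ring,
      Int.negOnePow_add, Algebra.smul_def (R := V) (A := W), map_zsmul]
    have h1 : lshift (-(r + l) - 1) (extend h A) = extend h (lshift (-(r + l) - 1) A) :=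
      (mapCoeff_lshift (fun a => (h a).symm) _ A).symm
    rw [h1, coeff_extend]
    simp only [zsmul_eq_mul, Units.smul_def, Units.val_mul, smul_eq_mul]
    push_cast
    -- The sign `(-1)^r` occurs twice, once from `(λ - z)^m` and once from the adjoint.
    have h2 : ((r.negOnePow : ℤ) : W) * ((r.negOnePow : ℤ) : W) = 1 := by
      rw [← Int.cast_mul, ← Units.val_mul, Int.units_mul_self]
      simp
    linear_combination ((l : ℤ).negOnePow : ℤ) * ((Ring.choose (r + l) l : ℤ) : W) *
      algebraMap V W ((lshift (-(r + l) - 1) A).coeff (-1)) * ((e : W →ₗ[F] W) ^ l) f * h2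
  · intro n hn
    rw [(mono_orderLE 0 f).lshift _ n (by omega), zero_mul]

/-- The sum over `p` from `ι_z` is the expansion of a differential part with coefficients on the
right (`coeff_mul_plus`); the sum over `q` expands `∂^p ∘ a` inside the product with `B`. -/
theorem applyOp_adlerFst (h : ∀ a, e (algebraMap V W a) = algebraMap V W (d a))
    (f : W) (B A : PseudoDiffOp d) (r s : ℤ) :
    applyOp e f (adlerFst B A r s) =
      (extend h B * plus (lshift (-r - 1) (mono e 0 f) * extend h A)).coeff s := by
  have hfin := finite_support_adlerFst B A r s
  rw [coeff_mul_plus, adlerFst]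
  refine ((applyOp e f).toAddMonoidHom.map_finsum hfin).trans ?_
  rw [finsum_curry]
  · refine finsum_congr fun p => ?_
    rw [coeff_mul_lshift_mono_zero]
    refine finsum_congr fun q => ?_
    change applyOp e f _ = _
    rw [map_zsmul, applyOp_C_mul, applyOp_lamAdd_pow h, applyOp_evalLamSub_adjoint h, lshift_mul,
      lshift_lshift, show -(p : ℤ) - 1 + (-r - 1) = -(r + p + 1) - 1 by ring,
      Algebra.smul_def (R := V) (A := W)]
    rfl
  · refine hfin.subset fun x hx h0 => hx ?_
    exact (congrArg (applyOp e f) h0).trans (map_zero _)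

/-- Here the powers `z^{-p-1}`, `p ≥ 0`, select the nonnegative coefficients of `B ∂^{-r-1}`, and
the function `f` is moved past `plus`. -/
theorem applyOp_adlerSnd (h : ∀ a, e (algebraMap V W a) = algebraMap V W (d a))
    (f : W) (B A : PseudoDiffOp d) (r s : ℤ) :
    applyOp e f (adlerSnd B A r s) =
      (plus (extend h B * lshift (-r - 1) (mono e 0 f)) * extend h A).coeff s := by
  have hfin := finite_support_adlerSnd B A r s
  rw [← mono_one_mul, ← mul_assoc, plus_mul_mono_zero, mul_assoc, coeff_plus_mul, adlerSnd]
  refine ((applyOp e f).toAddMonoidHom.map_finsum hfin).trans ?_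
  rw [finsum_curry]
  · refine finsum_congr fun p => ?_
    rw [coeff_lshift, mul_finsum' _ _ (finite_support_lshift _ _ _)]
    refine finsum_congr fun q => ?_
    change applyOp e f _ = _
    rw [map_nsmul, applyOp_C_mul, applyOp_lamAdd_pow h, applyOp_C, coeff_mono_zero_mul,
      coeff_mul_mono_one, coeff_extend, coeff_extend, Ring.choose_natCast,
      Algebra.smul_def (R := V) (A := W), Algebra.smul_def (R := V) (A := W), natCast_zsmul, mul_smul_comm, show (p : ℤ) - (-r - 1) = r + p + 1 by ring,
      show s - (p : ℤ) + q = s + q - p by ring, mul_comm f]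
  · refine hfin.subset fun x hx h0 => hx ?_
    exact (congrArg (applyOp e f) h0).trans (map_zero _)

end PseudoDiffOp

end

/-! ### The derivations defined by a bracket, and the AGD identity -/

section

open PseudoDiffOp

variable {F V W : Type*} [Field F] [CommRing V] [Algebra F V] [CommRing W] [Algebra F W]
  [Algebra V W] {d : Derivation F V V}

/-- Application of a derivation to all coefficients. -/
def derivMap (d : Derivation F V V) (e : Derivation F W W) :
    Derivation F V W →+ PseudoDiffOp d →+ PseudoDiffOp e :=
  AddMonoidHom.mk' (fun δ => mapCoeff e (δ : V →ₗ[F] W).toAddMonoidHom) fun _ _ => rfl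

variable {e : Derivation F W W}

@[simp] theorem coeff_derivMap (δ : Derivation F V W) (A : PseudoDiffOp d) (n : ℤ) :
    (derivMap d e δ A).coeff n = δ (A.coeff n) := rfl

theorem derivMap_mul (h : ∀ a, e (algebraMap V W a) = algebraMap V W (d a)) (δ : Derivation F V W)
    (hδ : ∀ a, δ (d a) = e (δ a)) (A B : PseudoDiffOp d) : derivMap d e δ (A * B) =
      derivMap d e δ A * extend h B + extend h A * derivMap d e δ B :=
  mapCoeff_mul h δ hδ A B

theorem derivMap_const (δ : Derivation F V W) (c : F) : derivMap d e δ (const d c) = 0 := by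
  ext n
  rw [coeff_derivMap, coeff_const]
  split_ifs <;> simp

section Matrix

variable {m n o : Type*} [Fintype n]

theorem map_derivMap_mul (h : ∀ a, e (algebraMap V W a) = algebraMap V W (d a))
    (δ : Derivation F V W)
    (hδ : ∀ a, δ (d a) = e (δ a)) (A : Matrix m n (PseudoDiffOp d))
    (B : Matrix n o (PseudoDiffOp d)) : (A * B).map (derivMap d e δ) =
      A.map (derivMap d e δ) * B.map (extend h) + A.map (extend h) * B.map (derivMap d e δ) := by
  ext1 i j
  simp only [Matrix.map_apply, Matrix.mul_apply, Matrix.add_apply, map_sum, derivMap_mul h δ hδ,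
    Finset.sum_add_distrib]

theorem map_plus_const_mul (J : Matrix m n F) (X : Matrix n o (PseudoDiffOp e)) :
    (J.map (const e) * X).map plus = J.map (const e) * X.map plus := by
  ext1 i j
  simp only [Matrix.map_apply, Matrix.mul_apply, map_sum, const_eq_mono, plus_mono_zero_mul]

theorem map_plus_mul_const (X : Matrix m n (PseudoDiffOp e)) (I : Matrix n o F) :
    (X * I.map (const e)).map plus = X.map plus * I.map (const e) := by
  ext1 i j
  simp only [Matrix.map_apply, Matrix.mul_apply, map_sum, const_eq_mono, plus_mul_mono_zero]

end Matrix

theorem map_derivMap_const (δ : Derivation F V W) {m n : Type*} (J : Matrix m n F) :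
    (J.map (const d)).map (derivMap d e δ) = 0 := by
  ext1 i j
  simp only [Matrix.map_apply, derivMap_const, Matrix.zero_apply]

theorem map_extend_const [IsScalarTower F V W]
    (h : ∀ a, e (algebraMap V W a) = algebraMap V W (d a)) {m n : Type*}
    (J : Matrix m n F) :
    (J.map (const d)).map (extend h) = J.map (const e) := by
  ext1 i j
  simp only [Matrix.map_apply, const_eq_mono, extend_mono]
  rw [← IsScalarTower.algebraMap_apply]

namespace LambdaBracket

variable [IsScalarTower F V W] (L : LambdaBracket d)

/-- The derivation `c ↦ {a_∂ c} f` from `V` to a differential algebra `W` over `V`. -/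
def hamiltonian (e : Derivation F W W) : V →+ W →+ Derivation F V W :=
  AddMonoidHom.mk' (fun a => AddMonoidHom.mk' (fun f =>
    Derivation.mk' ((applyOp e f).restrictScalars F ∘ₗ L.br a) fun b c => by
      simp only [LinearMap.comp_apply, LinearMap.restrictScalars_apply, L.leibniz_right]
      rw [mul_comm _ (C c), mul_comm _ (C b), map_add, applyOp_C_mul, applyOp_C_mul, add_comm])
    fun f g => Derivation.ext fun c => applyOp_add_left e f g (L.br a c))
    fun a b => AddMonoidHom.ext fun f => Derivation.ext fun c => by
      change applyOp e f (L.br (a + b) c) = applyOp e f (L.br a c) + applyOp e f (L.br b c)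
      rw [map_add, LinearMap.add_apply, map_add]

theorem hamiltonian_apply (a c : V) (f : W) :
    L.hamiltonian e a f c = applyOp e f (L.br a c) := rfl

theorem hamiltonian_mul (h : ∀ a, e (algebraMap V W a) = algebraMap V W (d a)) (a b : V) (f : W) :
    L.hamiltonian e (a * b) f =
      L.hamiltonian e a (algebraMap V W b * f) + L.hamiltonian e b (algebraMap V W a * f) := by
  ext c
  rw [Derivation.add_apply, hamiltonian_apply, hamiltonian_apply, hamiltonian_apply,
    L.leibniz_left, map_add, applyOp_substApply h, applyOp_substApply h,
    Algebra.smul_def (R := V) (A := W), Algebra.smul_def (R := V) (A := W)]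

theorem hamiltonian_deriv_left (a : V) (f : W) :
    L.hamiltonian e (d a) f = -L.hamiltonian e a (e f) := by
  ext c
  rw [Derivation.neg_apply, hamiltonian_apply, hamiltonian_apply, L.deriv_left, map_neg,
    applyOp_X_mul]

theorem hamiltonian_deriv (h : ∀ a, e (algebraMap V W a) = algebraMap V W (d a)) (a c : V) (f : W) :
    L.hamiltonian e a f (d c) = e (L.hamiltonian e a f c) := by
  rw [hamiltonian_apply, hamiltonian_apply, L.deriv_right, applyOp_lamAdd h]

theorem pairing_deriv (h : ∀ a, e (algebraMap V W a) = algebraMap V W (d a)) (P : PseudoDiffOp e)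
    (A : PseudoDiffOp d) (c : V) :
    pairing (L.hamiltonian e) P A (d c) = e (pairing (L.hamiltonian e) P A c) :=
  finsum_induction (p := fun δ : Derivation F V W => δ (d c) = e (δ c)) (by simp)
    (fun δ η hδ hη => by rw [Derivation.add_apply, Derivation.add_apply, map_add, hδ, hη])
    fun n => L.hamiltonian_deriv h _ _ _

/-- `∂^n ∂^{-r-1} ∘ f` has nonzero residue only for `n = r`: these test operators isolate one
coefficient of `A`. -/
theorem pairing_lshift_mono_zero (r : ℤ) (f : W) (A : PseudoDiffOp d) :
    pairing (L.hamiltonian e) (lshift (-r - 1) (mono e 0 f)) A =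
      L.hamiltonian e (A.coeff r) f := by
  rw [pairing, finsum_eq_single _ r, lshift_lshift, res_lshift_mono_zero, if_pos (by ring)]
  intro n hn
  rw [lshift_lshift, res_lshift_mono_zero, if_neg (by omega), map_zero]

/-- An Adler type operator satisfies the Adler–Gelfand–Dickey identity over every differential
algebra over `V`. -/
theorem derivMap_pairing_of_isAdlerType
    (h : ∀ a, e (algebraMap V W a) = algebraMap V W (d a)) {m n : Type*}
    {A : Matrix m n (PseudoDiffOp d)} (hA : IsAdlerType L A) (i : m) (j : n) (k : m) (l : n)
    (P : PseudoDiffOp e) : derivMap d e (pairing (L.hamiltonian e) P (A i j)) (A k l) =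
      extend h (A k j) * plus (P * extend h (A i l)) -
        plus (extend h (A k j) * P) * extend h (A i l) := by
  obtain ⟨N₁, h₁⟩ := (A i j).coeff_bounded
  obtain ⟨N₂, h₂⟩ := (A i l).coeff_bounded
  obtain ⟨N₃, h₃⟩ := (A k j).coeff_bounded
  have h₁ : (A i j).OrderLE N₁ := h₁
  have h₂ : (A i l).OrderLE N₂ := h₂
  have h₃ : (A k j).OrderLE N₃ := h₃
  revert P
  -- Below this order the pairing and both differential parts vanish. The leading terms `∂^m ∘ a`
  -- are exactly the test operators on which the identity is the Adler identity.
  refine order_induction (fun X Y hX hY => ?_) (-2 - |N₁| - |N₂| - |N₃|) (fun P hP => ?_)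
    (fun m a => lshift m (mono e 0 a)) lshift_mono_zero_sub_orderLE fun r f => ?_
  · rw [pairing_add_left, map_add, AddMonoidHom.add_apply, hX, hY, add_mul, map_add, mul_add,
      mul_add, map_add, add_mul]
    abel
  · have := le_abs_self N₁
    have := le_abs_self N₂
    have := le_abs_self N₃
    have := abs_nonneg N₁
    have := abs_nonneg N₂
    have := abs_nonneg N₃
    rw [pairing_eq_zero _ hP h₁ (by omega), (hP.mul (h₂.extend h)).plus_eq_zero (by omega),
      ((h₃.extend h).mul hP).plus_eq_zero (by omega)]
    simp
  · ext s
    obtain ⟨q, rfl⟩ : ∃ q : ℤ, r = -q - 1 := ⟨-r - 1, by ring⟩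
    rw [pairing_lshift_mono_zero, coeff_derivMap, hamiltonian_apply, hA i j k l q s, map_sub,
      applyOp_adlerFst h, applyOp_adlerSnd h, PseudoDiffOp.coeff_sub]

/-! ### The matrix form of the identity -/

/-- The pairing of matrices of operators. -/
def matrixPairing (e : Derivation F W W) {m n : Type*} [Fintype m] [Fintype n]
    (P : Matrix n m (PseudoDiffOp e)) (A : Matrix m n (PseudoDiffOp d)) : Derivation F V W :=
  ∑ i, ∑ j, pairing (L.hamiltonian e) (P j i) (A i j)

/-- The Adler–Gelfand–Dickey identity, up to the factor `c`. -/
def IsAGD (h : ∀ a, e (algebraMap V W a) = algebraMap V W (d a)) {m n : Type*} [Fintype m]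
    [Fintype n] (c : ℤ) (A : Matrix m n (PseudoDiffOp d)) : Prop :=
  ∀ P : Matrix n m (PseudoDiffOp e), A.map (derivMap d e (L.matrixPairing e P A)) =
    c • (A.map (extend h) * (P * A.map (extend h)).map plus -
      (A.map (extend h) * P).map plus * A.map (extend h))

variable (h : ∀ a, e (algebraMap V W a) = algebraMap V W (d a))
  {m n o p : Type*} [Fintype m] [Fintype n] [Fintype o] [Fintype p]

theorem isAGD_of_isAdlerType {A : Matrix m n (PseudoDiffOp d)} (hA : IsAdlerType L A) :
    L.IsAGD h 1 A := by
  intro P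
  ext1 k l
  simp only [one_smul, Matrix.map_apply, Matrix.sub_apply, Matrix.mul_apply, matrixPairing,
    map_sum, AddMonoidHom.finsetSum_apply, L.derivMap_pairing_of_isAdlerType h hA,
    Finset.sum_sub_distrib, Finset.mul_sum, Finset.sum_mul]
  congr 1
  exact Finset.sum_comm

theorem matrixPairing_single [DecidableEq m] [DecidableEq n] (i : m) (j : n) (P : PseudoDiffOp e)
    (A : Matrix m n (PseudoDiffOp d)) :
    L.matrixPairing e (Matrix.single j i P) A = pairing (L.hamiltonian e) P (A i j) := by
  have h0 : ∀ X : PseudoDiffOp d, pairing (L.hamiltonian e) (0 : PseudoDiffOp e) X = 0 := fun X => by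
    rw [← pairingHom_apply, map_zero, AddMonoidHom.zero_apply]
  rw [matrixPairing, Finset.sum_eq_single i, Finset.sum_eq_single j, Matrix.single_apply_same]
  · intro b _ hb
    rw [Matrix.single_apply_of_row_ne hb.symm, h0]
  · simp
  · intro b _ hb
    refine Finset.sum_eq_zero fun x _ => ?_
    rw [Matrix.single_apply_of_col_ne _ _ hb.symm, h0]
  · simp

theorem IsAGD.derivMap_pairing {A : Matrix m n (PseudoDiffOp d)} (hA : L.IsAGD h 1 A)
    (i : m) (j : n) (k : m) (l : n)
    (P : PseudoDiffOp e) : derivMap d e (pairing (L.hamiltonian e) P (A i j)) (A k l) =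
      extend h (A k j) * plus (P * extend h (A i l)) -
        plus (extend h (A k j) * P) * extend h (A i l) := by
  classical
  have h1 := congrFun (congrFun (hA (Matrix.single j i P)) k) l
  rw [matrixPairing_single, one_smul, Matrix.map_apply] at h1
  rw [h1, Matrix.sub_apply, Matrix.mul_apply, Matrix.mul_apply, Finset.sum_eq_single j,
    Finset.sum_eq_single i]
  · simp [Matrix.map_apply]
  · intro b _ hb
    simp [Matrix.map_apply, hb]
  · simp
  · intro b _ hb
    simp [Matrix.map_apply, hb]
  · simp

/-- If `f` is such that `P(∂) f` determines `P ∈ V[λ]`, then the Adler–Gelfand–Dickey identity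
implies the Adler identity. -/
theorem IsAGD.isAdlerType {A : Matrix m n (PseudoDiffOp d)} (hA : L.IsAGD h 1 A) (f : W)
    (hf : Function.Injective (applyOp (V := V) e f)) : IsAdlerType L A := by
  intro i j k l r s
  apply hf
  have h1 := congrArg (coeffHom e s)
    (hA.derivMap_pairing L h i j k l (lshift (-r - 1) (mono e 0 f)))
  rw [pairing_lshift_mono_zero, coeffHom_apply, coeff_derivMap, hamiltonian_apply] at h1
  rw [h1, map_sub (applyOp e f), applyOp_adlerFst h, applyOp_adlerSnd h]
  rfl

/-- The scalar rule `pairing_mul` summed over entries; reordering the sums is cyclicity of the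
trace. -/
theorem matrixPairing_mul (P : Matrix o m (PseudoDiffOp e)) (A : Matrix m n (PseudoDiffOp d))
    (B : Matrix n o (PseudoDiffOp d)) : L.matrixPairing e P (A * B) =
      L.matrixPairing e (B.map (extend h) * P) A + L.matrixPairing e (P * A.map (extend h)) B := by
  simp only [matrixPairing, Matrix.mul_apply, ← pairingHom_apply, map_sum,
    AddMonoidHom.finsetSum_apply, Matrix.map_apply]
  simp only [pairingHom_apply, pairing_mul h (L.hamiltonian_mul h) L.hamiltonian_deriv_left,
    Finset.sum_add_distrib]
  congr 1
  · exact Finset.sum_congr rfl fun i _ => Finset.sum_comm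
  · rw [Finset.sum_comm]
    refine (Finset.sum_congr rfl fun i _ => Finset.sum_comm).trans ?_
    exact Finset.sum_comm

/-- `{1_λ c} = 0` by the left Leibniz rule, hence `{c'_λ c} = 0` for every scalar `c'`. -/
theorem matrixPairing_const (h : ∀ a, e (algebraMap V W a) = algebraMap V W (d a))
    (P : Matrix n m (PseudoDiffOp e)) (A : Matrix m n F) :
    L.matrixPairing e P (A.map (const d)) = 0 := by
  have h0 : ∀ (Q : PseudoDiffOp e) c, pairing (L.hamiltonian e) Q (const d c) = 0 := fun Q c => by
    rw [const_eq_mono, pairing_mono]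
    ext x
    rw [hamiltonian_apply, Algebra.algebraMap_eq_smul_one, map_smul, LinearMap.smul_apply,
      LinearMap.map_smul_of_tower, ← hamiltonian_apply, map_one_eq_zero (L.hamiltonian_mul h),
      Derivation.zero_apply, smul_zero]
  simp only [matrixPairing, Matrix.map_apply, h0, Finset.sum_const_zero]

theorem matrixPairing_deriv (h : ∀ a, e (algebraMap V W a) = algebraMap V W (d a))
    (P : Matrix n m (PseudoDiffOp e)) (A : Matrix m n (PseudoDiffOp d))
    (c : V) : L.matrixPairing e P A (d c) = e (L.matrixPairing e P A c) := by
  have h1 : ∀ δ η : Derivation F V W, δ (d c) = e (δ c) → η (d c) = e (η c) →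
      (δ + η) (d c) = e ((δ + η) c) := fun δ η hδ hη => by
    rw [Derivation.add_apply, Derivation.add_apply, map_add, hδ, hη]
  have h2 : (0 : Derivation F V W) (d c) = e ((0 : Derivation F V W) c) := by simp
  exact Finset.sum_induction _ (fun δ : Derivation F V W => δ (d c) = e (δ c)) h1 h2 fun i _ =>
    Finset.sum_induction _ (fun δ : Derivation F V W => δ (d c) = e (δ c)) h1 h2 fun j _ =>
      L.pairing_deriv h _ _ c

theorem IsAGD.inverse [DecidableEq n] {c : ℤ} {A B : Matrix n n (PseudoDiffOp d)}
    (hA : L.IsAGD h c A) (hAB : IsInverse A B) : L.IsAGD h (-c) B := by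
  intro P
  have hone : (1 : Matrix n n (PseudoDiffOp d)) = (1 : Matrix n n F).map (const d) := by
    rw [Matrix.map_one]
    · ext; simp [coeff_const]
    · rfl
  obtain ⟨h1, h2⟩ := hAB
  have h3 : A.map (extend h) * B.map (extend h) = 1 := by
    rw [← Matrix.map_mul, h1, Matrix.map_one _ (map_zero _) (map_one _)]
  have h4 : B.map (extend h) * A.map (extend h) = 1 := by
    rw [← Matrix.map_mul, h2, Matrix.map_one _ (map_zero _) (map_one _)]
  -- Pair `P B⁻¹ = P A` with the constant matrix `A B = 1`, here written as `P` times the extended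
  -- `B` on the test side.
  have h5 : L.matrixPairing e P B =
      -L.matrixPairing e (B.map (extend h) * (P * B.map (extend h))) A := by
    have := L.matrixPairing_mul h (P * B.map (extend h)) A B
    rw [h1, hone, L.matrixPairing_const h, mul_assoc P, h4, mul_one] at this
    exact (neg_eq_of_add_eq_zero_right this.symm).symm
  set δ := L.matrixPairing e P B with hδ
  have h6 := map_derivMap_mul h δ (L.matrixPairing_deriv h P B) A B
  have h7 : (A * B).map (derivMap d e δ) = 0 := by
    rw [h1, hone, map_derivMap_const]
  -- With test matrix `B P B`, one outer factor cancels in each product: `(BPB) A = BP` and `A (BPB)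
  -- = PB`.
  have h8 : A.map (derivMap d e δ) = -(c • (A.map (extend h) * (B.map (extend h) * P).map plus -
      (P * B.map (extend h)).map plus * A.map (extend h))) := by
    have := hA (B.map (extend h) * (P * B.map (extend h)))
    rw [mul_assoc, mul_assoc, h4, mul_one, ← mul_assoc (A.map _), h3, one_mul] at this
    rw [← this, h5]
    ext1 i j
    simp only [Matrix.map_apply, map_neg, AddMonoidHom.neg_apply, Matrix.neg_apply]
  rw [h7, h8] at h6
  have h9 : B.map (derivMap d e δ) =
      B.map (extend h) * (A.map (extend h) * B.map (derivMap d e δ)) := by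
    rw [← mul_assoc, h4, one_mul]
  have h10 : A.map (extend h) * B.map (derivMap d e δ) =
      c • (A.map (extend h) * (B.map (extend h) * P).map plus -
        (P * B.map (extend h)).map plus * A.map (extend h)) * B.map (extend h) := by
    rw [neg_mul] at h6
    exact (neg_add_eq_zero.mp h6.symm).symm
  rw [h9, h10, smul_mul_assoc, mul_smul_comm, sub_mul, mul_sub, mul_assoc (Matrix.map _ plus), h3,
    mul_one, ← mul_assoc, ← mul_assoc, h4, one_mul, neg_smul, ← smul_neg, neg_sub]

theorem IsAGD.const_mul_mul_const {c : ℤ} {A : Matrix m n (PseudoDiffOp d)}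
    (hA : L.IsAGD h c A) (I : Matrix n o F) (J : Matrix p m F) :
    L.IsAGD h c (J.map (const d) * A * I.map (const d)) := by
  intro P
  have h1 : L.matrixPairing e P (J.map (const d) * A * I.map (const d)) =
      L.matrixPairing e (I.map (const e) * P * J.map (const e)) A := by
    rw [L.matrixPairing_mul h, L.matrixPairing_const h, add_zero, L.matrixPairing_mul h,
      L.matrixPairing_const h, zero_add, map_extend_const, map_extend_const]
  rw [h1]
  have h2 := hA (I.map (const e) * P * J.map (const e))
  have h3 := L.matrixPairing_deriv h (I.map (const e) * P * J.map (const e)) A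
  set δ := L.matrixPairing e (I.map (const e) * P * J.map (const e)) A
  rw [map_derivMap_mul h δ h3, map_derivMap_mul h δ h3, map_derivMap_const, map_derivMap_const,
    Matrix.mul_zero, add_zero, Matrix.zero_mul, zero_add, h2, Matrix.map_mul (f := extend h),
    Matrix.map_mul (f := extend h), map_extend_const, map_extend_const]
  simp only [Matrix.mul_assoc, map_plus_const_mul]
  simp only [← Matrix.mul_assoc, map_plus_mul_const]
  simp only [Matrix.mul_smul, Matrix.smul_mul, Matrix.mul_sub, Matrix.sub_mul, Matrix.mul_assoc]

end LambdaBracket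

end

/-! ### The test algebra `V[X]` with `X' = X²` -/

section

open PseudoDiffOp

variable {F V : Type*} [Field F] [CommRing V] [Algebra F V]

/-- The linear map underlying `polyDeriv`. -/
def polyDerivAux (d : Derivation F V V) : V[X] →ₗ[F] V[X] :=
  lsum fun n => (monomial n : V →ₗ[V] V[X]).restrictScalars F ∘ₗ (d : V →ₗ[F] V) +
    n • (monomial (n + 1) : V →ₗ[V] V[X]).restrictScalars F

theorem polyDerivAux_monomial (d : Derivation F V V) (n : ℕ) (a : V) :
    polyDerivAux d (monomial n a) = monomial n (d a) + n • monomial (n + 1) a := by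
  refine (sum_monomial_index a _ ?_).trans rfl
  rw [map_zero]

/-- The extension of a derivation of `V` to `V[X]` such that `X ↦ X²`. -/
def polyDeriv (d : Derivation F V V) : Derivation F V[X] V[X] :=
  Derivation.mk' (polyDerivAux d) fun P Q => by
    induction P using Polynomial.induction_on' with
    | add P P' hP hP' => simp only [add_mul, map_add, smul_add, add_smul, hP, hP']; abel
    | monomial m a =>
      induction Q using Polynomial.induction_on' with
      | add Q Q' hQ hQ' => simp only [mul_add, map_add, smul_add, add_smul, hQ, hQ']; abel
      | monomial n b =>
        simp only [monomial_mul_monomial, polyDerivAux_monomial, Derivation.leibniz, smul_eq_mul,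
          mul_add, map_add, add_smul, mul_smul_comm]
        rw [show n + (m + 1) = m + n + 1 by ring, show m + (n + 1) = m + n + 1 by ring,
          add_comm n m, mul_comm b a]
        abel

variable {d : Derivation F V V}

theorem polyDeriv_monomial (n : ℕ) (a : V) :
    polyDeriv d (monomial n a) = monomial n (d a) + n • monomial (n + 1) a :=
  polyDerivAux_monomial d n a

theorem polyDeriv_C (a : V) : polyDeriv d (C a) = C (d a) := by
  simpa using polyDeriv_monomial (d := d) 0 a

theorem polyDeriv_pow_X (k : ℕ) :
    ((polyDeriv d : V[X] →ₗ[F] V[X]) ^ k) X = monomial (k + 1) ((k.factorial : ℕ) : V) := by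
  induction k with
  | zero => simp [monomial_one_one_eq_X]
  | succ k ih =>
    rw [pow_succ', Module.End.mul_apply, ih, Derivation.coeFn_coe, polyDeriv_monomial,
      Derivation.map_natCast, map_zero, zero_add, ← map_nsmul, nsmul_eq_mul, Nat.factorial_succ]
    push_cast
    rfl

/-- The coefficient of `X^{n+1}` in `P(∂) X` is `n! p_n`, and `n!` is a unit of `V` because it is
one in `F`. -/
theorem applyOp_polyDeriv_X_injective [CharZero F] :
    Function.Injective (applyOp (V := V) (polyDeriv d) X) := by
  have hcoeff : ∀ (P : V[X]) (n : ℕ), (applyOp (polyDeriv d) X P).coeff (n + 1) =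
      P.coeff n * (n.factorial : V) := by
    intro P n
    induction P using Polynomial.induction_on' with
    | add P Q hP hQ => rw [map_add, Polynomial.coeff_add, Polynomial.coeff_add, hP, hQ, add_mul]
    | monomial m a =>
      rw [applyOp_monomial, polyDeriv_pow_X, coeff_smul, coeff_monomial, coeff_monomial]
      by_cases h : m = n <;> simp [h]
  have hunit : ∀ n : ℕ, IsUnit ((n.factorial : ℕ) : V) := fun n => by
    have := (IsUnit.mk0 ((n.factorial : ℕ) : F)
      (Nat.cast_ne_zero.mpr n.factorial_ne_zero)).map (algebraMap F V)
    rwa [map_natCast] at this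
  intro P Q hPQ
  refine Polynomial.ext fun n => (hunit n).mul_left_injective ?_
  simp only
  rw [← hcoeff, ← hcoeff, hPQ]

end

end AdlerType

end

theorem proposition4p5 {F V : Type*} [Field F] [CharZero F] [CommRing V] [Algebra F V]
    (d : Derivation F V V) (L : AdlerType.LambdaBracket d) (N M : ℕ) (hMN : M ≤ N)
    (A : Matrix (Fin N) (Fin N) (AdlerType.PseudoDiffOp d)) (hA : AdlerType.IsAdlerType L A)
    (I : Matrix (Fin N) (Fin M) F) (J : Matrix (Fin M) (Fin N) F)
    (Q : Matrix (Fin M) (Fin M) (AdlerType.PseudoDiffOp d))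
    (hQ : AdlerType.IsQuasideterminant A (I.map (AdlerType.PseudoDiffOp.const d))
      (J.map (AdlerType.PseudoDiffOp.const d)) Q) :
    AdlerType.IsAdlerType L Q := by
  obtain ⟨B, hAB, hBQ⟩ := hQ
  have h : ∀ a, AdlerType.polyDeriv d (algebraMap V V[X] a) = algebraMap V V[X] (d a) :=
    AdlerType.polyDeriv_C
  -- The factor runs through 1, -1, -1 and `-(-1) = 1`.
  have h1 := (((L.isAGD_of_isAdlerType h hA).inverse L h hAB).const_mul_mul_const L h I J).inverse
    L h hBQ
  rw [neg_neg] at h1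
  exact h1.isAdlerType L h X AdlerType.applyOp_polyDeriv_X_injective
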